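/- **Setting.** Let $\mathcal X$ be a measurable space, $A=\mathcal Y=\{0,1\}$, and let $\mathcal H$ be a class of measurable classifiers $h:\mathcal X\to\{0,1\}$ with finite VC dimension $d$. Let $\mathbb P$ be a probability distribution of $(X,A,Y)$ on $\mathcal X\times A\times\mathcal Y$, and let $P_{1a}=\mathbb P(Y=1,A=a)$, where $0<P_{10}\le P_{11}$. We make the usual measurability assumption on $\mathcal H$: for all $m$ and $b\in\{0,1\}^m$, the set of those $(x_1,\dots,x_m)\in\mathcal X^m$ for which some $h\in\mathcal H$ has $h(x_i)=b_i$ for all $i$ is measurable with respect to the completion of the $m$-fold product of the law of $X$ (this holds, for instance, if $\mathcal H$ is countable). For $\lambda\ge 0$ put $$L_\lambda(h)=\mathbb P(h(X)\ne Y)+\lambda\,\bigl|\mathbb P(h(X)=1\mid A=0,Y=1)-\mathbb P(h(X)=1\mid A=1,Y=1)\bigr| .$$ For a dataset $S=((x_i,a_i,y_i))_{i=1}^n$ put $$\widehat L_\lambda(h,S)=\frac1n\sum_{i=1}^n \mathbf 1\{h(x_i)\neq y_i\}+\lambda\,\bigl|\widehat\gamma_{0}-\widehat\gamma_{1}\bigr|,\qquad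 \widehat\gamma_a=\frac{\sum_i\mathbf 1\{h(x_i)=1,a_i=a,y_i=1\}}{\sum_i\mathbf 1\{a_i=a,y_i=1\}},$$ with the convention $0/0=0$. Let $\mathcal L$ be any learner that maps every nonempty finite dataset $S$ to a minimizer of $\widehat L_\lambda(\cdot,S)$ over $\mathcal H$. A malicious adversary of power $\alpha\in[0,1/2)$ acts as follows: a clean i.i.d. sample $S^c$ of size $n$ is drawn from $\mathbb P$; each index is marked independently (and independently of $S^c$) with probability $\alpha$; knowing everything, the adversary replaces the marked points arbitrarily, possibly at random, and leaves the unmarked ones unchanged. The result is the corrupted dataset $S^p$, and $\mathbb P^{\mathcal A}$ denotes probability over the clean data, the marks and the randomness of the adversary. **Theorem.** There is an absolute constant $C>0$ such that, for all $\mathcal X,\mathcal H,d,\lambda,\mathcal L,\mathbb P$ as above, every $\alpha\in[0,1/2)$, every $\delta\in(0,1)$, every $$n\ \ge\ \max\Bigl\{\frac{8\log(16/\delta)}{(1-\alpha)P_{10}},\ \frac{12\log(12/\delta)}{\alpha},\ \frac d2\Bigr\}$$ (the second term being omitted if $\alpha=0$), and every malicious adversary $\mathcal A$ of power $\alpha$,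 $$\mathbb P^{\mathcal A}\Bigl(L_\lambda(\mathcal L(S^p))\ \le\ \inf_{h\in\mathcal H}L_\lambda(h)+\Delta_\lambda\Bigr)>1-\delta ,$$ where $$\Delta_\lambda=3\alpha+2\lambda\,\frac{2\alpha}{P_{10}/3+\alpha}+C\left(\sqrt{\frac{d\log(2en/d)+\log(1/\delta)}{n}}+\lambda\sqrt{\frac{d\log(2en/d)+\log(1/\delta)}{P_{10}\,n}}\right),$$ and $d\log(2en/d)$ is read as $0$ for $d=0$. That is, $\Delta_\lambda=3\alpha+2\lambda\frac{2\alpha}{P_{10}/3+\alpha}+\widetilde{\mathcal O}\bigl(\sqrt{d/n}+\lambda\sqrt{d/(P_{10}n)}\bigr)$. (If the event is not measurable, the claim is that its complement has outer probability less than $\delta$.) -/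

import Mathlib

open MeasureTheory

universe u v

namespace FairLearning

/-- A labelled example `(x, a, y)`: input, protected attribute, label. The binary attribute and
the binary label take values in `Bool`, with `false` for `0` and `true` for `1`. -/
abbrev Example (X : Type u) : Type u := X × Bool × Bool

/-- A dataset of size `n`. -/
abbrev Dataset (X : Type u) (n : ℕ) : Type u := Fin n → Example X

/-- A classifier `X → {0, 1}`. -/
abbrev Classifier (X : Type u) : Type u := X → Bool

/-- `H` shatters the finite set `s`: every labelling of `s` is realized by a member of `H`. -/
def Shatters {X : Type u} (H : Set (Classifier X)) (s : Finset X) : Prop :=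
  ∀ t ⊆ s, ∃ h ∈ H, ∀ x ∈ s, h x = true ↔ x ∈ t

/-- The Vapnik-Chervonenkis dimension: supremum of the sizes of the shattered finite sets. -/
noncomputable def vcDim {X : Type u} (H : Set (Classifier X)) : ℕ∞ :=
  ⨆ (s : Finset X) (_ : Shatters H s), (s.card : ℕ∞)

/-- Measurability convention for a hypothesis class: every classifier is measurable, and, for each
labelling pattern `b` of `m` points, the set of the `m`-tuples of inputs on which some `h ∈ H`
realizes `b` is measurable for the completion of the `m`-fold product of the input marginal.
(Equivalently, suprema over `H` of functions of finitely many values of `h` are measurable.)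
It holds for countable classes of measurable classifiers, and for all the pointwise separable
ones. -/
def MeasurableClass {X : Type u} [MeasurableSpace X] (P : Measure (Example X))
    (H : Set (Classifier X)) : Prop :=
  (∀ h ∈ H, Measurable h) ∧
  ∀ (m : ℕ) (b : Fin m → Bool),
    NullMeasurableSet {x : Fin m → X | ∃ h ∈ H, ∀ i, h (x i) = b i}
      (Measure.pi fun _ : Fin m => P.map Prod.fst)

/-- The event `{A = a, Y = 1}`. -/
def posGroup (X : Type u) (a : Bool) : Set (Example X) := {z | z.2.1 = a ∧ z.2.2 = true}

/-- `P_{1a} = ℙ(Y = 1, A = a)`. -/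
noncomputable def posRate {X : Type u} [MeasurableSpace X] (P : Measure (Example X)) (a : Bool) :
    ℝ :=
  P.real (posGroup X a)

/-- The risk `ℙ(h(X) ≠ Y)`. -/
noncomputable def risk {X : Type u} [MeasurableSpace X] (P : Measure (Example X))
    (h : Classifier X) : ℝ :=
  P.real {z | h z.1 ≠ z.2.2}

/-- The true positive rate in group `a`: `ℙ(h(X) = 1 | A = a, Y = 1)`. -/
noncomputable def truePosRate {X : Type u} [MeasurableSpace X] (P : Measure (Example X))
    (h : Classifier X) (a : Bool) : ℝ :=
  (ProbabilityTheory.cond P (posGroup X a)).real {z | h z.1 = true}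

/-- The equal opportunity deviation measure of `h`. -/
noncomputable def oppDeviation {X : Type u} [MeasurableSpace X] (P : Measure (Example X))
    (h : Classifier X) : ℝ :=
  |truePosRate P h false - truePosRate P h true|

/-- The weighted objective `risk + lam * deviation`. -/
noncomputable def oppObjective {X : Type u} [MeasurableSpace X] (P : Measure (Example X))
    (lam : ℝ) (h : Classifier X) : ℝ :=
  risk P h + lam * oppDeviation P h

/-- The empirical risk of `h` on the dataset `S`. -/
noncomputable def empRisk {X : Type u} {n : ℕ} (S : Dataset X n) (h : Classifier X) : ℝ :=
  ((Finset.univ.filter fun i => h (S i).1 ≠ (S i).2.2).card : ℝ) / n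

/-- The empirical true positive rate of `h` in group `a`, with the convention `0 / 0 = 0`. -/
noncomputable def empTruePosRate {X : Type u} {n : ℕ} (S : Dataset X n) (h : Classifier X)
    (a : Bool) : ℝ :=
  ((Finset.univ.filter fun i =>
      h (S i).1 = true ∧ (S i).2.1 = a ∧ (S i).2.2 = true).card : ℝ) /
    ((Finset.univ.filter fun i => (S i).2.1 = a ∧ (S i).2.2 = true).card : ℝ)

/-- The empirical estimate of the equal opportunity deviation. -/
noncomputable def empOppDeviation {X : Type u} {n : ℕ} (S : Dataset X n) (h : Classifier X) : ℝ :=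
  |empTruePosRate S h false - empTruePosRate S h true|

/-- The empirical weighted objective. -/
noncomputable def empOppObjective {X : Type u} {n : ℕ} (lam : ℝ) (S : Dataset X n)
    (h : Classifier X) : ℝ :=
  empRisk S h + lam * empOppDeviation S h

/-- A learner maps datasets of any size to classifiers. -/
abbrev Learner (X : Type u) : Type u := (n : ℕ) → Dataset X n → Classifier X

/-- The learner always returns a minimizer over `H` of the empirical weighted objective. -/
def IsOppMinimizer {X : Type u} (H : Set (Classifier X)) (lam : ℝ) (L : Learner X) : Prop :=
  ∀ n : ℕ, 1 ≤ n → ∀ S : Dataset X n,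
    L n S ∈ H ∧ ∀ h ∈ H, empOppObjective lam S (L n S) ≤ empOppObjective lam S h

/-- A malicious adversary acting on datasets of size `n`: a randomized function (with a random
seed) of the clean dataset and of the marks (`true` = marked), which may replace the marked points
arbitrarily and leaves the other points unchanged. Since the function is arbitrary, it may depend
on every parameter of the learning problem; it is not even required to be measurable. -/
structure MaliciousAdversary (X : Type u) (n : ℕ) where
  /-- The space of the random seeds. -/
  Seed : Type v
  /-- The σ-algebra on the seeds. -/
  seedSpace : MeasurableSpace Seed
  /-- The law of the seed. -/
  seedLaw : Measure Seed
  /-- The law of the seed is a probability measure. -/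
  seedProb : IsProbabilityMeasure seedLaw
  /-- The corrupted dataset. -/
  corrupt : Dataset X n → (Fin n → Bool) → Seed → Dataset X n
  /-- Unmarked points are left unchanged. -/
  corrupt_unmarked : ∀ S marks r i, marks i = false → corrupt S marks r i = S i

attribute [instance] MaliciousAdversary.seedSpace MaliciousAdversary.seedProb

/-- The law of a single mark: `true` with probability `α`, `false` with probability `1 - α`. -/
noncomputable def markLaw (α : ℝ) : Measure Bool :=
  ENNReal.ofReal α • Measure.dirac true + ENNReal.ofReal (1 - α) • Measure.dirac false

/-- The joint law of all the randomness in the generation of the corrupted data, for an adversary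
of power `α`: the i.i.d. clean data, the independent marks, and the seed of the adversary. -/
noncomputable def processLaw {X : Type u} [MeasurableSpace X] {n : ℕ} (P : Measure (Example X))
    (α : ℝ) (𝒜 : MaliciousAdversary.{u, v} X n) :
    Measure (Dataset X n × (Fin n → Bool) × 𝒜.Seed) :=
  (Measure.pi fun _ => P).prod ((Measure.pi fun _ => markLaw α).prod 𝒜.seedLaw)

/-- The corrupted dataset as a function of the outcome of the generation process. -/
def corrupted {X : Type u} {n : ℕ} (𝒜 : MaliciousAdversary.{u, v} X n)
    (ω : Dataset X n × (Fin n → Bool) × 𝒜.Seed) : Dataset X n :=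
  𝒜.corrupt ω.1 ω.2.1 ω.2.2

/-- The irreducible error term `2α / (P₁₀ / 3 + α)`. -/
noncomputable def irreducibleOpp (α p : ℝ) : ℝ := 2 * α / (p / 3 + α)

/-- The squared statistical rate `d / n` with its logarithmic factors:
`(d log (2en / d) + log (1 / δ)) / n` (where `d log (2en / d) = 0` for `d = 0`). -/
noncomputable def logRate (d : ℕ) (δ n : ℝ) : ℝ :=
  (d * Real.log (2 * Real.exp 1 * n / d) + Real.log (1 / δ)) / n

/-- The excess error `3α + 2 lam Δ + C (√(d/n) + lam √(d/(p n)))`, the two rates carrying their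
logarithmic factors. -/
noncomputable def oppExcess (C α lam p : ℝ) (d n : ℕ) (δ : ℝ) : ℝ :=
  3 * α + lam * (2 * irreducibleOpp α p) +
    C * (Real.sqrt (logRate d δ n) + lam * Real.sqrt (logRate d δ n / p))

end FairLearning

/-!
On a good clean marked sample every adversary is harmless up to deterministic errors. If at most
`3αn/2` points are marked, empirical risks move by at most `3α/2`. If each group `a` keeps at least
`c = nP₁₀/4 ≤ n(1 - α)P₁ₐ/2` unmarked points, `k` corrupted points in it move its true positive
rates by at most `k/(c + k)`. This is concave in `k`, so an even split of the marked points between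
the groups is the worst case, and it costs `2α/(P₁₀/3 + α)`. A minimizer compares two classifiers,
which doubles both errors.

A sample is good with high probability by the Vapnik-Chervonenkis symmetrization argument.
Conditioning on membership in a group would change the sample size, so the deviation bound is
localized instead: if the counted events lie in a set with `m` expected hits, the random swaps of a
double sample only see its `O(m)` points in this set. This gives deviations of order `√(mK)` instead
of `√(nK)`, where `K = d log (2en/d) + log (1/δ)`.
-/

namespace FairLearning

section VCDimension

variable {X : Type u} {H : Set (Classifier X)}

theorem Shatters.card_le_vcDim {s : Finset X} (hs : Shatters H s) :
    (s.card : ℕ∞) ≤ vcDim H :=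
  le_iSup₂ (f := fun (t : Finset X) (_ : Shatters H t) => (t.card : ℕ∞)) s hs

theorem subsingleton_of_vcDim_eq_zero (hd : vcDim H = 0) : H.Subsingleton := by
  intro h hh g hg
  by_contra hne
  obtain ⟨x, hx⟩ := Function.ne_iff.1 hne
  have realized : ∀ c : Bool, ∃ f ∈ H, f x = c := fun c => by
    by_cases hc : h x = c
    · exact ⟨h, hh, hc⟩
    · exact ⟨g, hg, by cases c <;> simp_all⟩
  have hs : Shatters H {x} := fun t _ => by
    classical
    obtain ⟨f, hf, hfx⟩ := realized (decide (x ∈ t))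
    exact ⟨f, hf, by simp [hfx]⟩
  simpa [hd] using hs.card_le_vcDim

/-- The labellings of the points `x i` realized by `H`. -/
def patterns (H : Set (Classifier X)) {ι : Type*} (x : ι → X) : Set (ι → Bool) :=
  (fun h : Classifier X => h ∘ x) '' H

variable {d : ℕ} {ι : Type*} [Fintype ι]

/-- The patterns of `H` on the points `x i`, encoded as the sets of the indices that are labelled
`true`. It lets Mathlib's Sauer-Shelah lemma for finite set families apply to `H`. -/
noncomputable def trueSets (H : Set (Classifier X)) (x : ι → X) : Finset (Finset ι) :=
  ((fun b => Finset.univ.filter fun i => b i = true) '' patterns H x).toFinite.toFinset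

theorem card_trueSets (x : ι → X) : (trueSets H x).card = (patterns H x).ncard := by
  have hinj : Function.Injective fun b : ι → Bool => Finset.univ.filter fun i => b i = true :=
    fun b c hbc => funext fun i => by
      simpa using congrArg (i ∈ ·) hbc
  rw [trueSets, ← Set.ncard_eq_toFinset_card, Set.ncard_image_of_injective _ hinj]

theorem exists_of_trueSets_shatters [DecidableEq ι] {x : ι → X} {s : Finset ι}
    (hs : (trueSets H x).Shatters s) {t : Finset ι} (ht : t ⊆ s) :
    ∃ h ∈ H, ∀ i ∈ s, h (x i) = true ↔ i ∈ t := by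
  obtain ⟨u, hu, hsu⟩ := hs ht
  obtain ⟨_, ⟨h, hh, rfl⟩, rfl⟩ := (Set.Finite.mem_toFinset _).1 hu
  exact ⟨h, hh, fun i hi => by simp [← hsu, hi]⟩

theorem card_le_vcDim_of_trueSets_shatters [DecidableEq ι] {x : ι → X} {s : Finset ι}
    (hs : (trueSets H x).Shatters s) : (s.card : ℕ∞) ≤ vcDim H := by
  classical
  have hinj : Set.InjOn x s := fun i hi j hj hij => by
    obtain ⟨h, -, hh⟩ := exists_of_trueSets_shatters hs (Finset.singleton_subset_iff.2 hi)
    have hj' := (hh j hj).1 (hij ▸ (hh i hi).2 (Finset.mem_singleton_self i))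
    exact (Finset.mem_singleton.1 hj').symm
  have hsh : Shatters H (s.image x) := fun t _ => by
    obtain ⟨h, hh, hhs⟩ :=
      exists_of_trueSets_shatters hs (Finset.filter_subset (fun i => x i ∈ t) s)
    refine ⟨h, hh, Finset.forall_mem_image.2 fun i hi => ?_⟩
    simp [hhs i hi, hi]
  rw [← Finset.card_image_of_injOn hinj]
  exact hsh.card_le_vcDim

theorem ncard_patterns_le_sum_choose (hd : vcDim H ≤ d) (x : ι → X) :
    (patterns H x).ncard ≤ ∑ k ∈ Finset.Iic d, (Fintype.card ι).choose k := by
  classical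
  have hvc : (trueSets H x).vcDim ≤ d := Finset.sup_le fun s hs => by
    exact_mod_cast (card_le_vcDim_of_trueSets_shatters (Finset.mem_shatterer.1 hs)).trans hd
  calc (patterns H x).ncard = (trueSets H x).card := (card_trueSets x).symm
    _ ≤ (trueSets H x).shatterer.card := Finset.card_le_card_shatterer _
    _ ≤ ∑ k ∈ Finset.Iic (trueSets H x).vcDim, (Fintype.card ι).choose k :=
        Finset.card_shatterer_le_sum_vcDim
    _ ≤ ∑ k ∈ Finset.Iic d, (Fintype.card ι).choose k :=
        Finset.sum_le_sum_of_subset (Finset.Iic_subset_Iic.2 hvc)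

theorem pow_mul_sum_choose_le_one_add_pow {r : ℝ} (hr0 : 0 ≤ r) (hr1 : r ≤ 1) {m : ℕ}
    (hdm : d ≤ m) :
    r ^ d * ∑ k ∈ Finset.Iic d, (m.choose k : ℝ) ≤ (r + 1) ^ m :=
  calc r ^ d * ∑ k ∈ Finset.Iic d, (m.choose k : ℝ)
      ≤ ∑ k ∈ Finset.Iic d, r ^ k * (m.choose k : ℝ) := by
        rw [Finset.mul_sum]
        exact Finset.sum_le_sum fun k hk => mul_le_mul_of_nonneg_right
          (pow_le_pow_of_le_one hr0 hr1 (Finset.mem_Iic.1 hk)) (Nat.cast_nonneg _)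
    _ ≤ ∑ k ∈ Finset.range (m + 1), r ^ k * (m.choose k : ℝ) := by
        refine Finset.sum_le_sum_of_subset_of_nonneg (fun k hk => ?_) fun k _ _ => by positivity
        have := Finset.mem_Iic.1 hk
        exact Finset.mem_range.2 (by lia)
    _ = (r + 1) ^ m := by simp [add_pow]

theorem sum_choose_le_exp_mul_div_pow {m : ℕ} (hd : 0 < d) (hdm : d ≤ m) :
    ∑ k ∈ Finset.Iic d, (m.choose k : ℝ) ≤ (Real.exp 1 * m / d) ^ d := by
  have hm : 0 < m := hd.trans_le hdm
  -- The best choice of `r` in `∑ k ≤ d, choose m k ≤ r⁻ᵈ (1 + r)ᵐ ≤ r⁻ᵈ exp (r m)`.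
  set r : ℝ := d / m with hr
  have hr0 : 0 < r := by positivity
  have hr1 : r ≤ 1 := div_le_one_of_le₀ (by exact_mod_cast hdm) (by positivity)
  have hexp : (r + 1) ^ m ≤ Real.exp d :=
    calc (r + 1) ^ m ≤ Real.exp r ^ m := by
          gcongr
          exact Real.add_one_le_exp r
      _ = Real.exp d := by
          rw [← Real.exp_nat_mul, hr]
          congr 1
          field_simp
  have hbase : (Real.exp 1 * m / d) ^ d = Real.exp d / r ^ d := by
    rw [hr, div_pow, div_pow, mul_pow, ← Real.exp_nat_mul]
    field_simp
  rw [hbase, le_div_iff₀' (by positivity)]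
  exact (pow_mul_sum_choose_le_one_add_pow hr0.le hr1 hdm).trans hexp

theorem ncard_patterns_le (hd : vcDim H ≤ d) (hd0 : 0 < d) (hdι : d ≤ Fintype.card ι)
    (x : ι → X) :
    ((patterns H x).ncard : ℝ) ≤ (Real.exp 1 * Fintype.card ι / d) ^ d :=
  calc ((patterns H x).ncard : ℝ) ≤ ∑ k ∈ Finset.Iic d, ((Fintype.card ι).choose k : ℝ) := by
        exact_mod_cast ncard_patterns_le_sum_choose hd x
    _ ≤ (Real.exp 1 * Fintype.card ι / d) ^ d := sum_choose_le_exp_mul_div_pow hd0 hdι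

end VCDimension

theorem sq_div_three_le_one_add_mul_log_sub {x : ℝ} (h0 : 0 ≤ x) (h1 : x ≤ 1) :
    x ^ 2 / 3 ≤ (1 + x) * Real.log (1 + x) - x := by
  have hlog : (1 + x) * (2 * x / (x + 2)) ≤ (1 + x) * Real.log (1 + x) := by
    gcongr
    exact Real.le_log_one_add_of_nonneg h0
  have hfrac : x ^ 2 / 3 ≤ (1 + x) * (2 * x / (x + 2)) - x := by
    field_simp
    nlinarith [mul_nonneg h0 (sub_nonneg.2 h1)]
  linarith

theorem exp_neg_le_one_sub_add_sq_div_two {x : ℝ} (hx : 0 ≤ x) :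
    Real.exp (-x) ≤ 1 - x + x ^ 2 / 2 := by
  rw [Real.exp_neg, inv_le_iff_one_le_mul₀ (Real.exp_pos x)]
  calc (1 : ℝ) ≤ (1 - x + x ^ 2 / 2) * (1 + x + x ^ 2 / 2) := by nlinarith [sq_nonneg (x ^ 2)]
    _ ≤ (1 - x + x ^ 2 / 2) * Real.exp x := by
        gcongr
        · nlinarith [sq_nonneg (x - 1)]
        · exact Real.quadratic_le_exp_of_nonneg hx

section HitCount

variable {Z ι : Type*} [Fintype ι]

/-- The number of the points of the sample `z` that lie in `F`. It is real valued because it is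
only ever compared with its mean. -/
noncomputable def hitCount (F : Set Z) (z : ι → Z) : ℝ :=
  ∑ i, F.indicator 1 (z i)

theorem hitCount_nonneg (F : Set Z) (z : ι → Z) : 0 ≤ hitCount F z :=
  Finset.sum_nonneg fun _ _ => Set.indicator_nonneg (fun _ _ => zero_le_one) _

theorem exp_mul_indicator_one (F : Set Z) (s : ℝ) (x : Z) :
    Real.exp (s * F.indicator 1 x) = 1 + F.indicator 1 x * (Real.exp s - 1) := by
  by_cases hx : x ∈ F <;> simp [hx]

theorem exp_mul_hitCount (F : Set Z) (s : ℝ) (z : ι → Z) :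
    Real.exp (s * hitCount F z) = ∏ i, Real.exp (s * F.indicator 1 (z i)) := by
  rw [hitCount, Finset.mul_sum, Real.exp_sum]

variable [MeasurableSpace Z] {F : Set Z} (Q : Measure Z) [IsProbabilityMeasure Q]

theorem measurable_hitCount (hF : MeasurableSet F) :
    Measurable (hitCount F : (ι → Z) → ℝ) :=
  Finset.measurable_sum _ fun i _ => (measurable_one.indicator hF).comp (measurable_pi_apply i)

theorem integrable_indicator_one (hF : MeasurableSet F) : Integrable (F.indicator (1 : Z → ℝ)) Q :=
  (integrable_const 1).indicator hF

theorem integrable_exp_mul_indicator_one (hF : MeasurableSet F) (s : ℝ) :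
    Integrable (fun x => Real.exp (s * F.indicator 1 x)) Q := by
  simp only [exp_mul_indicator_one]
  exact (integrable_const 1).add ((integrable_indicator_one Q hF).mul_const _)

theorem integral_exp_mul_indicator_one (hF : MeasurableSet F) (s : ℝ) :
    ∫ x, Real.exp (s * F.indicator 1 x) ∂Q = 1 + Q.real F * (Real.exp s - 1) := by
  simp only [exp_mul_indicator_one]
  rw [integral_add (integrable_const 1) ((integrable_indicator_one Q hF).mul_const _),
    integral_mul_const, integral_indicator_one hF]
  simp

theorem integrable_exp_mul_hitCount (hF : MeasurableSet F) (s : ℝ) :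
    Integrable (fun z => Real.exp (s * hitCount F z)) (Measure.pi fun _ : ι => Q) := by
  simp only [exp_mul_hitCount]
  exact Integrable.fintype_prod (f := fun _ x => Real.exp (s * F.indicator 1 x))
    fun _ => integrable_exp_mul_indicator_one Q hF s

theorem mgf_hitCount_le (hF : MeasurableSet F) (s : ℝ) :
    ProbabilityTheory.mgf (hitCount F) (Measure.pi fun _ : ι => Q) s ≤
      Real.exp (Fintype.card ι * Q.real F * (Real.exp s - 1)) :=
  calc ProbabilityTheory.mgf (hitCount F) (Measure.pi fun _ : ι => Q) s
      = (∫ x, Real.exp (s * F.indicator 1 x) ∂Q) ^ Fintype.card ι := by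
        simp only [ProbabilityTheory.mgf, exp_mul_hitCount]
        exact integral_fintype_prod_eq_pow fun x => Real.exp (s * F.indicator 1 x)
    _ = (1 + Q.real F * (Real.exp s - 1)) ^ Fintype.card ι := by
        rw [integral_exp_mul_indicator_one Q hF]
    _ ≤ Real.exp (Q.real F * (Real.exp s - 1)) ^ Fintype.card ι := by
        gcongr
        · rw [← integral_exp_mul_indicator_one Q hF]
          exact integral_nonneg fun x => (Real.exp_pos (s * F.indicator 1 x)).le
        · rw [add_comm]
          exact Real.add_one_le_exp _
    _ = Real.exp (Fintype.card ι * Q.real F * (Real.exp s - 1)) := by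
        rw [← Real.exp_nat_mul, mul_assoc]

theorem measure_hitCount_ge_le_exp (hF : MeasurableSet F) {ε : ℝ} (h0 : 0 ≤ ε) (h1 : ε ≤ 1) :
    (Measure.pi fun _ : ι => Q).real
        {z | (1 + ε) * (Fintype.card ι * Q.real F) ≤ hitCount F z} ≤
      Real.exp (-(ε ^ 2 * (Fintype.card ι * Q.real F) / 3)) := by
  set m : ℝ := Fintype.card ι * Q.real F
  have hm0 : 0 ≤ m := by positivity
  calc (Measure.pi fun _ : ι => Q).real {z | (1 + ε) * m ≤ hitCount F z}
      ≤ Real.exp (-Real.log (1 + ε) * ((1 + ε) * m)) *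
          ProbabilityTheory.mgf (hitCount F) (Measure.pi fun _ : ι => Q) (Real.log (1 + ε)) :=
        ProbabilityTheory.measure_ge_le_exp_mul_mgf _ (Real.log_nonneg (by linarith))
          (integrable_exp_mul_hitCount Q hF _)
    _ ≤ Real.exp (-Real.log (1 + ε) * ((1 + ε) * m)) * Real.exp (m * ε) := by
        gcongr
        simpa [Real.exp_log (by linarith : 0 < 1 + ε)] using
          mgf_hitCount_le Q hF (Real.log (1 + ε))
    _ ≤ Real.exp (-(ε ^ 2 * m / 3)) := by
        rw [← Real.exp_add, Real.exp_le_exp]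
        nlinarith [mul_le_mul_of_nonneg_left (sq_div_three_le_one_add_mul_log_sub h0 h1) hm0]

theorem measure_hitCount_le_le_exp (hF : MeasurableSet F) {ε : ℝ} (h0 : 0 ≤ ε) :
    (Measure.pi fun _ : ι => Q).real
        {z | hitCount F z ≤ (1 - ε) * (Fintype.card ι * Q.real F)} ≤
      Real.exp (-(ε ^ 2 * (Fintype.card ι * Q.real F) / 2)) := by
  set m : ℝ := Fintype.card ι * Q.real F
  have hm0 : 0 ≤ m := by positivity
  calc (Measure.pi fun _ : ι => Q).real {z | hitCount F z ≤ (1 - ε) * m}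
      ≤ Real.exp (-(-ε) * ((1 - ε) * m)) *
          ProbabilityTheory.mgf (hitCount F) (Measure.pi fun _ : ι => Q) (-ε) :=
        ProbabilityTheory.measure_le_le_exp_mul_mgf _ (neg_nonpos.2 h0)
          (integrable_exp_mul_hitCount Q hF _)
    _ ≤ Real.exp (-(-ε) * ((1 - ε) * m)) * Real.exp (m * (Real.exp (-ε) - 1)) := by
        gcongr
        exact mgf_hitCount_le Q hF (-ε)
    _ ≤ Real.exp (-(ε ^ 2 * m / 2)) := by
        rw [← Real.exp_add, Real.exp_le_exp]
        nlinarith [mul_le_mul_of_nonneg_left (exp_neg_le_one_sub_add_sq_div_two h0) hm0]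

theorem memLp_indicator_one (hF : MeasurableSet F) : MemLp (F.indicator (1 : Z → ℝ)) 2 Q :=
  memLp_indicator_const 2 hF 1 (Or.inr (measure_ne_top Q F))

theorem memLp_hitCount (hF : MeasurableSet F) :
    MemLp (hitCount F) 2 (Measure.pi fun _ : ι => Q) :=
  memLp_finsetSum _ fun i _ =>
    (memLp_indicator_one Q hF).comp_measurePreserving (measurePreserving_eval (fun _ => Q) i)

theorem integral_hitCount (hF : MeasurableSet F) :
    ∫ z, hitCount F z ∂(Measure.pi fun _ : ι => Q) = Fintype.card ι * Q.real F := by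
  have hcoord : ∀ i : ι, ∫ z, F.indicator 1 (z i) ∂(Measure.pi fun _ : ι => Q) = Q.real F :=
    fun i => by
      rw [integral_comp_eval (X := fun _ : ι => Z) (integrable_indicator_one Q hF).1,
        integral_indicator_one hF]
  simp only [hitCount]
  rw [integral_finsetSum _ fun i _ => ?_]
  · simp [hcoord]
  · exact (measurePreserving_eval (fun _ => Q) i).integrable_comp_of_integrable
      (integrable_indicator_one Q hF)

theorem variance_hitCount_le (hF : MeasurableSet F) :
    ProbabilityTheory.variance (hitCount F) (Measure.pi fun _ : ι => Q) ≤
      Fintype.card ι * Q.real F := by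
  have hcoord : ProbabilityTheory.variance (F.indicator 1) Q ≤ Q.real F :=
    calc ProbabilityTheory.variance (F.indicator 1) Q
        ≤ ∫ x, (F.indicator (1 : Z → ℝ) ^ 2) x ∂Q :=
          ProbabilityTheory.variance_le_expectation_sq (integrable_indicator_one Q hF).1
      _ = ∫ x, F.indicator 1 x ∂Q := by
          congr 1 with x
          by_cases hx : x ∈ F <;> simp [hx]
      _ = Q.real F := integral_indicator_one hF
  have hsum : (hitCount F : (ι → Z) → ℝ) = ∑ i, fun z => F.indicator 1 (z i) := by
    funext z
    simp [hitCount]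
  calc ProbabilityTheory.variance (hitCount F) (Measure.pi fun _ : ι => Q)
      = ∑ _i : ι, ProbabilityTheory.variance (F.indicator 1) Q := by
        rw [hsum, ProbabilityTheory.variance_sum_pi fun _ => memLp_indicator_one Q hF]
    _ ≤ Fintype.card ι * Q.real F := by
        simpa using mul_le_mul_of_nonneg_left hcoord (Nat.cast_nonneg (Fintype.card ι))

theorem measure_abs_hitCount_sub_ge_le (hF : MeasurableSet F) {t : ℝ} (ht : 0 < t) :
    (Measure.pi fun _ : ι => Q).real
        {z | t ≤ |hitCount F z - Fintype.card ι * Q.real F|} ≤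
      Fintype.card ι * Q.real F / t ^ 2 := by
  have hcheb := ProbabilityTheory.meas_ge_le_variance_div_sq (memLp_hitCount (ι := ι) Q hF) ht
  rw [integral_hitCount Q hF] at hcheb
  refine (ENNReal.toReal_le_of_le_ofReal ?_ hcheb).trans ?_
  · exact div_nonneg (ProbabilityTheory.variance_nonneg _ _) (sq_nonneg t)
  · gcongr
    exact variance_hitCount_le Q hF

end HitCount

section RandomSigns

open ProbabilityTheory

/-- The law of a fair coin. It drives the random swaps of the symmetrization argument. -/
noncomputable def fairCoin : Measure Bool :=
  bernoulliMeasure true false ⟨1 / 2, by norm_num, by norm_num⟩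

instance : IsProbabilityMeasure fairCoin := by
  unfold fairCoin
  infer_instance

/-- The sign attached to the outcome of a coin toss: `true` stands for a swap, hence for `-1`. -/
def coinSign (c : Bool) : ℝ := bif c then -1 else 1

theorem integral_coinSign_mul (a : ℝ) : ∫ c, coinSign c * a ∂fairCoin = 0 := by
  simp only [fairCoin, integral_bernoulliMeasure, coinSign]
  norm_num

theorem hasSubgaussianMGF_coinSign_mul (a : ℝ) :
    HasSubgaussianMGF (fun c => coinSign c * a) (‖a‖₊ ^ 2) fairCoin := by
  have hmem : ∀ᵐ c ∂fairCoin, coinSign c * a ∈ Set.Icc (-|a|) |a| := .of_forall fun c => by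
    cases c <;> simp [coinSign, neg_abs_le, le_abs_self, neg_le_abs]
  have hparam : ‖a‖₊ ^ 2 = (‖|a| - -|a|‖₊ / 2) ^ 2 := by
    ext
    push_cast
    rw [sub_neg_eq_add, ← two_mul]
    simp
  rw [hparam]
  exact hasSubgaussianMGF_of_mem_Icc_of_integral_eq_zero (.of_discrete) hmem
    (integral_coinSign_mul a)

variable {ι : Type*} [Fintype ι]

theorem hasSubgaussianMGF_sum_coinSign_mul (a : ι → ℝ) :
    HasSubgaussianMGF (fun σ : ι → Bool => ∑ i, coinSign (σ i) * a i) (∑ i, ‖a i‖₊ ^ 2)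
      (Measure.pi fun _ => fairCoin) := by
  refine HasSubgaussianMGF.sum_of_iIndepFun
    (iIndepFun_pi (X := fun i c => coinSign c * a i) fun i => .of_discrete) fun i _ => ?_
  refine HasSubgaussianMGF.of_map (Y := fun σ : ι → Bool => σ i)
    (X := fun c => coinSign c * a i) (measurable_pi_apply i).aemeasurable ?_
  rw [(measurePreserving_eval (fun _ : ι => fairCoin) i).map_eq]
  exact hasSubgaussianMGF_coinSign_mul (a i)

theorem measure_lt_abs_sum_coinSign_mul_le {a : ι → ℝ} {V t : ℝ} (hV : ∑ i, a i ^ 2 ≤ V)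
    (ht : 0 ≤ t) :
    (Measure.pi fun _ : ι => fairCoin).real {σ | t < |∑ i, coinSign (σ i) * a i|} ≤
      2 * Real.exp (-t ^ 2 / (2 * V)) := by
  lift V to NNReal using (Finset.sum_nonneg fun i _ => sq_nonneg (a i)).trans hV
  set S : (ι → Bool) → ℝ := fun σ => ∑ i, coinSign (σ i) * a i
  have hsub : HasSubgaussianMGF S V (Measure.pi fun _ => fairCoin) :=
    ⟨(hasSubgaussianMGF_sum_coinSign_mul a).integrable_exp_mul, fun s =>
      ((hasSubgaussianMGF_sum_coinSign_mul a).mgf_le s).trans <| Real.exp_le_exp.2 <| by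
        gcongr
        rw [← NNReal.coe_le_coe]
        simpa using hV⟩
  calc (Measure.pi fun _ : ι => fairCoin).real {σ | t < |S σ|}
      ≤ (Measure.pi fun _ : ι => fairCoin).real ({σ | t ≤ S σ} ∪ {σ | t ≤ (-S) σ}) :=
        measureReal_mono fun σ (hσ : t < |S σ|) => (lt_abs.1 hσ).imp le_of_lt le_of_lt
    _ ≤ Real.exp (-t ^ 2 / (2 * V)) + Real.exp (-t ^ 2 / (2 * V)) :=
        (measureReal_union_le _ _).trans
          (add_le_add (hsub.measure_ge_le ht) (hsub.neg.measure_ge_le ht))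
    _ = 2 * Real.exp (-t ^ 2 / (2 * V)) := (two_mul _).symm

end RandomSigns

section Swap

variable {Z ι : Type*}

/-- The permutation of the index set `ι ⊕ ι` of a double sample that exchanges the two copies of
`i` whenever `σ i` is `true`. -/
def swapAt (σ : ι → Bool) : Equiv.Perm (ι ⊕ ι) :=
  Function.Involutive.toPerm (fun j => bif σ (j.elim id id) then j.swap else j) fun j => by
    cases j <;> rename_i i <;> cases h : σ i <;> simp [h]

theorem swapAt_inl (σ : ι → Bool) (i : ι) :
    swapAt σ (Sum.inl i) = bif σ i then Sum.inr i else Sum.inl i :=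
  rfl

theorem swapAt_inr (σ : ι → Bool) (i : ι) :
    swapAt σ (Sum.inr i) = bif σ i then Sum.inl i else Sum.inr i :=
  rfl

/-- The difference between the two copies of `i` of the membership in `A`. -/
noncomputable def pairGap (A : Set (ι ⊕ ι)) (i : ι) : ℝ :=
  A.indicator 1 (Sum.inl i) - A.indicator 1 (Sum.inr i)

theorem pairGap_preimage_swapAt (σ : ι → Bool) (A : Set (ι ⊕ ι)) (i : ι) :
    pairGap (swapAt σ ⁻¹' A) i = coinSign (σ i) * pairGap A i := by
  change A.indicator 1 (swapAt σ (Sum.inl i)) - A.indicator 1 (swapAt σ (Sum.inr i)) = _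
  rw [swapAt_inl, swapAt_inr, pairGap]
  cases σ i <;> simp [coinSign]

theorem sq_pairGap_le (A : Set (ι ⊕ ι)) (i : ι) :
    pairGap A i ^ 2 ≤ A.indicator 1 (Sum.inl i) + A.indicator 1 (Sum.inr i) := by
  by_cases hl : Sum.inl i ∈ A <;> by_cases hr : Sum.inr i ∈ A <;> simp [pairGap, hl, hr]

variable [Fintype ι]

theorem sum_pairGap_preimage (F : Set Z) (w : ι ⊕ ι → Z) :
    ∑ i, pairGap (w ⁻¹' F) i = hitCount F (w ∘ Sum.inl) - hitCount F (w ∘ Sum.inr) :=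
  Finset.sum_sub_distrib _ _

theorem sum_sq_pairGap_preimage_le {F G : Set Z} (hFG : F ⊆ G) (w : ι ⊕ ι → Z) :
    ∑ i, pairGap (w ⁻¹' F) i ^ 2 ≤ hitCount G w := by
  rw [hitCount, Fintype.sum_sum_type, ← Finset.sum_add_distrib]
  exact Finset.sum_le_sum fun i _ => (sq_pairGap_le _ i).trans <|
    add_le_add (Set.indicator_le_indicator_of_subset hFG (fun _ => zero_le_one) _)
      (Set.indicator_le_indicator_of_subset hFG (fun _ => zero_le_one) _)

theorem hitCount_comp_perm (F : Set Z) (w : ι → Z) (e : Equiv.Perm ι) :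
    hitCount F (w ∘ e) = hitCount F w :=
  Equiv.sum_comp e fun i => F.indicator 1 (w i)

theorem measurePreserving_comp_perm [MeasurableSpace Z] (Q : Measure Z) [SigmaFinite Q]
    (e : Equiv.Perm ι) :
    MeasurePreserving (fun w : ι → Z => w ∘ e) (Measure.pi fun _ => Q) (Measure.pi fun _ => Q) := by
  convert measurePreserving_piCongrLeft (fun _ : ι => Q) e.symm using 1
  funext w i
  exact by
    simpa using
      (MeasurableEquiv.piCongrLeft_apply_apply (β := fun _ => Z) e.symm w (e i)).symm

end Swap

section Symmetrization

theorem measureReal_le_of_forall_section_le {Ω I : Type*} [MeasurableSpace Ω] [MeasurableSpace I]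
    [Countable I] [DiscreteMeasurableSpace I] {μ : Measure Ω} [IsProbabilityMeasure μ]
    (ν : Measure I) [IsProbabilityMeasure ν] {f : I → Ω → Ω}
    (hf : ∀ i, MeasurePreserving (f i) μ μ) {E : Set Ω} (hE : NullMeasurableSet E μ) {c : ℝ}
    (hc : ∀ ω, ν.real {i | f i ω ∈ E} ≤ c) : μ.real E ≤ c := by
  obtain ⟨E', hE'E, hE', hae⟩ := hE.exists_measurable_subset_ae_eq
  have hmeas : MeasurableSet {x : Ω × I | f x.2 x.1 ∈ E'} :=
    (measurable_from_prod_countable_left fun i => (hf i).measurable) hE'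
  have hconst : ∀ i, μ {ω | f i ω ∈ E'} = μ E := fun i =>
    ((hf i).measure_preimage hE'.nullMeasurableSet).trans (measure_congr hae)
  obtain ⟨ω₀⟩ : Nonempty Ω := nonempty_of_isProbabilityMeasure μ
  refine ENNReal.toReal_le_of_le_ofReal (measureReal_nonneg.trans (hc ω₀)) ?_
  calc μ E = ∫⁻ i, μ {ω | f i ω ∈ E'} ∂ν := by simp [hconst]
    _ = (μ.prod ν) {x | f x.2 x.1 ∈ E'} := (Measure.prod_apply_symm hmeas).symm
    _ = ∫⁻ ω, ν {i | f i ω ∈ E'} ∂μ := Measure.prod_apply hmeas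
    _ ≤ ∫⁻ _, ENNReal.ofReal c ∂μ := by
        refine lintegral_mono fun ω => ?_
        rw [← ofReal_measureReal]
        exact ENNReal.ofReal_le_ofReal
          ((measureReal_mono (μ := ν) fun i hi => hE'E hi).trans (hc ω))
    _ = ENNReal.ofReal c := by simp

theorem measureReal_le_two_mul_prod {Ω Ω' : Type*} [MeasurableSpace Ω] [MeasurableSpace Ω']
    {μ : Measure Ω} [IsProbabilityMeasure μ] {ν : Measure Ω'} [IsProbabilityMeasure ν]
    {E : Set Ω} {D : Set (Ω × Ω')} (hD : ∀ ω ∈ E, 1 / 2 ≤ ν.real (Prod.mk ω ⁻¹' D)) :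
    μ.real E ≤ 2 * (μ.prod ν).real D := by
  set D' := toMeasurable (μ.prod ν) D
  have hhalf : ∀ ω ∈ E, (1 : ENNReal) ≤ 2 * ν (Prod.mk ω ⁻¹' D') := fun ω hω => by
    have hreal : 1 / 2 ≤ ν.real (Prod.mk ω ⁻¹' D') :=
      (hD ω hω).trans (measureReal_mono (Set.preimage_mono (subset_toMeasurable _ D)))
    rw [← ENNReal.ofReal_one, ← ofReal_measureReal, ← ENNReal.ofReal_ofNat 2,
      ← ENNReal.ofReal_mul zero_le_two]
    exact ENNReal.ofReal_le_ofReal (by linarith)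
  have hle : μ E ≤ 2 * (μ.prod ν) D :=
    calc μ E ≤ μ {ω | 1 ≤ 2 * ν (Prod.mk ω ⁻¹' D')} := measure_mono hhalf
      _ ≤ ∫⁻ ω, 2 * ν (Prod.mk ω ⁻¹' D') ∂μ := by
          simpa using mul_meas_ge_le_lintegral₀ (μ := μ) (AEMeasurable.const_mul
            (measurable_measure_prodMk_left
              (measurableSet_toMeasurable (μ.prod ν) D)).aemeasurable 2) 1
      _ = 2 * (μ.prod ν) D := by
          rw [lintegral_const_mul' _ _ (by simp),
            ← Measure.prod_apply (measurableSet_toMeasurable _ _), measure_toMeasurable]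
  simpa [Measure.real] using ENNReal.toReal_mono (by finiteness) hle

variable {Z ι : Type*} {κ : Type*}

/-- The traces on the points `w j` of the sets of the family `𝓕`, as sets of indices. -/
def traces (𝓕 : Set (Set Z)) (w : κ → Z) : Set (Set κ) :=
  (fun F => w ⁻¹' F) '' 𝓕

theorem traces_comp_perm (𝓕 : Set (Set Z)) (w : κ → Z) (e : Equiv.Perm κ) :
    traces 𝓕 (w ∘ e) = (fun A => e ⁻¹' A) '' traces 𝓕 w := by
  simp only [traces, Set.image_image, Set.preimage_comp]

variable [Fintype ι]

/-- The event that some set of the family `𝓕` hits the two halves of the double sample a number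
of times differing by more than `t`. It depends on the family only through its traces, which is
what makes it measurable. -/
def gapEvent (𝓕 : Set (Set Z)) (t : ℝ) : Set (ι ⊕ ι → Z) :=
  {w | ∃ A ∈ traces 𝓕 w, t < |∑ i, pairGap A i|}

theorem measure_swapAt_mem_gapEvent_le {𝓕 : Set (Set Z)} {G : Set Z} (hG : ∀ F ∈ 𝓕, F ⊆ G)
    {w : ι ⊕ ι → Z} {N V t : ℝ} (hN : ((traces 𝓕 w).ncard : ℝ) ≤ N) (hV : hitCount G w ≤ V)
    (ht : 0 ≤ t) :
    (Measure.pi fun _ : ι => fairCoin).real {σ | w ∘ swapAt σ ∈ gapEvent 𝓕 t} ≤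
      2 * N * Real.exp (-t ^ 2 / (2 * V)) := by
  classical
  set μ := Measure.pi fun _ : ι => fairCoin
  have hsum : ∀ A ∈ traces 𝓕 w, ∑ i, pairGap A i ^ 2 ≤ V := by
    rintro _ ⟨F, hF, rfl⟩
    exact (sum_sq_pairGap_preimage_le (hG F hF) w).trans hV
  have hunion : {σ | w ∘ swapAt σ ∈ gapEvent 𝓕 t} ⊆
      ⋃ A ∈ (traces 𝓕 w).toFinset, {σ | t < |∑ i, coinSign (σ i) * pairGap A i|} := by
    rintro σ ⟨B, hB, hgap⟩
    rw [traces_comp_perm] at hB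
    obtain ⟨A, hA, rfl⟩ := hB
    simp only [pairGap_preimage_swapAt] at hgap
    exact Set.mem_biUnion (Set.mem_toFinset.2 hA) hgap
  calc μ.real {σ | w ∘ swapAt σ ∈ gapEvent 𝓕 t}
      ≤ ∑ A ∈ (traces 𝓕 w).toFinset, μ.real {σ | t < |∑ i, coinSign (σ i) * pairGap A i|} :=
        (measureReal_mono hunion (measure_ne_top μ _)).trans (measureReal_biUnion_finset_le _ _)
    _ ≤ ∑ A ∈ (traces 𝓕 w).toFinset, 2 * Real.exp (-t ^ 2 / (2 * V)) :=
        Finset.sum_le_sum fun A hA =>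
          measure_lt_abs_sum_coinSign_mul_le (hsum A (Set.mem_toFinset.1 hA)) ht
    _ = 2 * (traces 𝓕 w).ncard * Real.exp (-t ^ 2 / (2 * V)) := by
        rw [Finset.sum_const, nsmul_eq_mul, ← Set.ncard_eq_toFinset_card']
        ring
    _ ≤ 2 * N * Real.exp (-t ^ 2 / (2 * V)) := by gcongr

variable [MeasurableSpace Z] (Q : Measure Z) {𝓕 : Set (Set Z)} {G : Set Z}

theorem nullMeasurableSet_gapEvent
    (hnull : ∀ A, NullMeasurableSet {w | A ∈ traces 𝓕 w} (Measure.pi fun _ : ι ⊕ ι => Q)) (t : ℝ) :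
    NullMeasurableSet (gapEvent 𝓕 t) (Measure.pi fun _ : ι ⊕ ι => Q) := by
  have hunion : gapEvent 𝓕 t =
      ⋃ A ∈ {A : Set (ι ⊕ ι) | t < |∑ i, pairGap A i|}, {w | A ∈ traces 𝓕 w} := by
    ext w
    simp [gapEvent, and_comm]
  rw [hunion]
  exact .biUnion (Set.to_countable _) fun A _ => hnull A

/-- The event that the number of hits of some set of the family `𝓕` is off its mean by more than
`t`. -/
def deviationEvent (𝓕 : Set (Set Z)) (t : ℝ) : Set (ι → Z) :=
  {z | ∃ F ∈ 𝓕, t < |hitCount F z - Fintype.card ι * Q.real F|}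

variable [IsProbabilityMeasure Q]

theorem measure_gapEvent_le (hGm : MeasurableSet G) (hG : ∀ F ∈ 𝓕, F ⊆ G)
    (hnull : ∀ A, NullMeasurableSet {w | A ∈ traces 𝓕 w} (Measure.pi fun _ : ι ⊕ ι => Q))
    {N t : ℝ} (hN : ∀ w : ι ⊕ ι → Z, ((traces 𝓕 w).ncard : ℝ) ≤ N) (ht : 0 ≤ t) :
    (Measure.pi fun _ : ι ⊕ ι => Q).real (gapEvent 𝓕 t) ≤
      2 * N * Real.exp (-t ^ 2 / (8 * (Fintype.card ι * Q.real G))) +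
        Real.exp (-(2 * (Fintype.card ι * Q.real G) / 3)) := by
  set p : ℝ := Fintype.card ι * Q.real G
  set μ := Measure.pi fun _ : ι ⊕ ι => Q
  -- The swaps leave the total number of hits unchanged, so it may be bounded beforehand.
  set E := gapEvent 𝓕 t ∩ {w : ι ⊕ ι → Z | hitCount G w ≤ 4 * p}
  have hE : NullMeasurableSet E μ := (nullMeasurableSet_gapEvent Q hnull t).inter
    (measurableSet_le (measurable_hitCount hGm) measurable_const).nullMeasurableSet
  have hfew : μ.real E ≤ 2 * N * Real.exp (-t ^ 2 / (8 * p)) := by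
    refine measureReal_le_of_forall_section_le (Measure.pi fun _ : ι => fairCoin)
      (f := fun σ w => w ∘ swapAt σ) (fun σ => measurePreserving_comp_perm Q (swapAt σ)) hE
      fun w => ?_
    by_cases hw : hitCount G w ≤ 4 * p
    · refine (measureReal_mono fun σ hσ => hσ.1).trans
        ((measure_swapAt_mem_gapEvent_le hG (hN w) hw ht).trans_eq ?_)
      ring_nf
    · have hempty : {σ | w ∘ swapAt σ ∈ E} = ∅ := Set.eq_empty_of_forall_notMem fun σ hσ =>
        hw ((hitCount_comp_perm G w (swapAt σ)).symm.trans_le hσ.2)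
      rw [hempty, measureReal_empty]
      have := (Nat.cast_nonneg _).trans (hN w)
      positivity
  have hmany : μ.real {w | (1 + 1) * (2 * p) ≤ hitCount G w} ≤ Real.exp (-(2 * p / 3)) := by
    have h := measure_hitCount_ge_le_exp (ι := ι ⊕ ι) Q hGm zero_le_one le_rfl
    simpa [p, two_mul, add_mul] using h
  calc μ.real (gapEvent 𝓕 t)
      ≤ μ.real (E ∪ {w | (1 + 1) * (2 * p) ≤ hitCount G w}) :=
        measureReal_mono fun w hw => (le_total (hitCount G w) (4 * p)).imp (⟨hw, ·⟩)
          fun h => show (1 + 1) * (2 * p) ≤ hitCount G w by linarith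
    _ ≤ 2 * N * Real.exp (-t ^ 2 / (8 * p)) + Real.exp (-(2 * p / 3)) :=
        (measureReal_union_le _ _).trans (add_le_add hfew hmany)

theorem half_le_measure_abs_hitCount_sub_lt {F : Set Z} (hF : MeasurableSet F) {t : ℝ}
    (ht : 0 < t) (hvar : 8 * (Fintype.card ι * Q.real F) ≤ t ^ 2) :
    1 / 2 ≤ (Measure.pi fun _ : ι => Q).real
      {z | |hitCount F z - Fintype.card ι * Q.real F| < t / 2} := by
  set p : ℝ := Fintype.card ι * Q.real F
  have hmeas : MeasurableSet {z : ι → Z | t / 2 ≤ |hitCount F z - p|} :=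
    measurableSet_le measurable_const ((measurable_hitCount hF).sub_const p).abs
  have hcompl : {z : ι → Z | |hitCount F z - p| < t / 2} =
      {z | t / 2 ≤ |hitCount F z - p|}ᶜ := by
    ext z
    simp
  rw [hcompl, probReal_compl_eq_one_sub hmeas]
  have hcheb := measure_abs_hitCount_sub_ge_le (ι := ι) Q hF (half_pos ht)
  have hratio : p / (t / 2) ^ 2 ≤ 1 / 2 := by
    rw [div_le_iff₀ (by positivity)]
    linarith
  linarith

theorem measure_deviationEvent_le_two_mul_gapEvent (h𝓕 : ∀ F ∈ 𝓕, MeasurableSet F)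
    (hG : ∀ F ∈ 𝓕, F ⊆ G) {t : ℝ} (ht : 0 < t)
    (hvar : 8 * (Fintype.card ι * Q.real G) ≤ t ^ 2) :
    (Measure.pi fun _ : ι => Q).real (deviationEvent Q 𝓕 t) ≤
      2 * (Measure.pi fun _ : ι ⊕ ι => Q).real (gapEvent 𝓕 (t / 2)) := by
  have hsplit := measurePreserving_sumPiEquivProdPi_symm (fun _ : ι ⊕ ι => Q)
  rw [measureReal_def (s := gapEvent 𝓕 (t / 2)), ← hsplit.measure_preimage_equiv]
  refine measureReal_le_two_mul_prod fun z hz => ?_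
  obtain ⟨F, hF, hdev⟩ := hz
  have hFG : Q.real F ≤ Q.real G := measureReal_mono (hG F hF)
  have hvarF : 8 * (Fintype.card ι * Q.real F) ≤ t ^ 2 := le_trans (by gcongr) hvar
  refine (half_le_measure_abs_hitCount_sub_lt Q (h𝓕 F hF) ht hvarF).trans
    (measureReal_mono fun z' hz' => ⟨_, ⟨F, hF, rfl⟩, ?_⟩)
  rw [sum_pairGap_preimage]
  change t / 2 < |hitCount F z - hitCount F z'|
  have htri := abs_sub_le (hitCount F z) (hitCount F z') (Fintype.card ι * Q.real F)
  have hdev' : |hitCount F z' - Fintype.card ι * Q.real F| < t / 2 := hz'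
  linarith

theorem measure_deviationEvent_le (hGm : MeasurableSet G) (h𝓕 : ∀ F ∈ 𝓕, MeasurableSet F)
    (hG : ∀ F ∈ 𝓕, F ⊆ G)
    (hnull : ∀ A, NullMeasurableSet {w | A ∈ traces 𝓕 w} (Measure.pi fun _ : ι ⊕ ι => Q))
    {N t : ℝ} (hN : ∀ w : ι ⊕ ι → Z, ((traces 𝓕 w).ncard : ℝ) ≤ N) (ht : 0 < t)
    (hvar : 8 * (Fintype.card ι * Q.real G) ≤ t ^ 2) :
    (Measure.pi fun _ : ι => Q).real (deviationEvent Q 𝓕 t) ≤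
      2 * (2 * N * Real.exp (-t ^ 2 / (32 * (Fintype.card ι * Q.real G))) +
        Real.exp (-(2 * (Fintype.card ι * Q.real G) / 3))) := by
  refine (measure_deviationEvent_le_two_mul_gapEvent Q h𝓕 hG ht hvar).trans ?_
  refine (mul_le_mul_of_nonneg_left
    (measure_gapEvent_le Q hGm hG hnull hN (half_pos ht).le) zero_le_two).trans_eq ?_
  ring_nf

end Symmetrization

section UniformDeviation

/-- The radius of the uniform deviation bounds around an expected number of hits `m`: a class of
sets with at most `δ * exp K` traces deviates by more with probability at most `δ / 8`. The
constant turns the factor `exp (-t ^ 2 / (32 * m))` left by the symmetrization into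
`exp (-6 * K)`. -/
noncomputable def deviationRadius (m K : ℝ) : ℝ := √(192 * m * K)

variable {ι Z : Type*} [Fintype ι] [MeasurableSpace Z] (Q : Measure Z) [IsProbabilityMeasure Q]

theorem two_mul_growth_mul_exp_add_exp_le {N p δ K : ℝ} (hδ : 0 < δ) (hδ1 : δ < 1) (hK : 1 ≤ K)
    (hNK : N ≤ δ * Real.exp K) (hp : 8 * Real.log (16 / δ) ≤ p) :
    2 * (2 * N * Real.exp (-(6 * K)) + Real.exp (-(2 * p / 3))) ≤ δ / 8 := by
  have hlog : 0 < Real.log (16 / δ) := Real.log_pos (by rw [lt_div_iff₀ hδ]; linarith)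
  have hgrowth : N * Real.exp (-(6 * K)) ≤ δ / 64 := by
    have hexp_neg_five : Real.exp (-5) ≤ 1 / 64 := by
      rw [Real.exp_neg, ← one_div]
      gcongr
      calc (64 : ℝ) ≤ 2.7 ^ 5 := by norm_num
        _ ≤ Real.exp 1 ^ 5 := by gcongr; linarith [Real.exp_one_gt_d9]
        _ = Real.exp 5 := by rw [← Real.exp_nat_mul]; norm_num
    calc N * Real.exp (-(6 * K)) ≤ δ * Real.exp K * Real.exp (-(6 * K)) := by gcongr
      _ = δ * Real.exp (-(5 * K)) := by
        rw [mul_assoc, ← Real.exp_add]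
        ring_nf
      _ ≤ δ * Real.exp (-5) := by gcongr; linarith
      _ ≤ δ / 64 := by linarith [mul_le_mul_of_nonneg_left hexp_neg_five hδ.le]
  have htail : Real.exp (-(2 * p / 3)) ≤ δ / 32 := by
    calc Real.exp (-(2 * p / 3)) ≤ Real.exp (-(2 * Real.log (16 / δ))) := by gcongr; linarith
      _ = (δ / 16) ^ 2 := by
        rw [Real.exp_neg, two_mul, Real.exp_add, Real.exp_log (by positivity)]
        field_simp
      _ ≤ δ / 32 := by nlinarith
  linarith

theorem measure_deviationEvent_le_of_growth {𝓕 : Set (Set Z)} {G : Set Z}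
    (hGm : MeasurableSet G) (h𝓕 : ∀ F ∈ 𝓕, MeasurableSet F) (hG : ∀ F ∈ 𝓕, F ⊆ G)
    (hnull : ∀ A, NullMeasurableSet {w | A ∈ traces 𝓕 w} (Measure.pi fun _ : ι ⊕ ι => Q))
    {δ K : ℝ} (hN : ∀ w : ι ⊕ ι → Z, ((traces 𝓕 w).ncard : ℝ) ≤ δ * Real.exp K)
    (hδ : 0 < δ) (hδ1 : δ < 1) (hK : 1 ≤ K)
    (hp : 8 * Real.log (16 / δ) ≤ Fintype.card ι * Q.real G) :
    (Measure.pi fun _ : ι => Q).real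
      (deviationEvent Q 𝓕 (deviationRadius (Fintype.card ι * Q.real G) K)) ≤ δ / 8 := by
  set p := Fintype.card ι * Q.real G with hp_def
  have hlog : 0 < Real.log (16 / δ) := Real.log_pos (by rw [lt_div_iff₀ hδ]; linarith)
  have hp0 : 0 < p := by linarith
  have hsq : deviationRadius p K ^ 2 = 192 * p * K := Real.sq_sqrt (by positivity)
  have hradius : 0 < deviationRadius p K := Real.sqrt_pos.2 (by positivity)
  refine (measure_deviationEvent_le Q hGm h𝓕 hG hnull hN hradius (by rw [hsq]; nlinarith)).trans ?_
  rw [hsq, ← hp_def, show -(192 * p * K) / (32 * p) = -(6 * K) by field_simp; norm_num]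
  exact two_mul_growth_mul_exp_add_exp_le hδ hδ1 hK le_rfl hp

theorem measure_lt_abs_hitCount_sub_le {G : Set Z} (hG : MeasurableSet G) {δ K : ℝ} (hδ : 0 < δ)
    (hδ1 : δ < 1) (hK : 1 ≤ K) (hδK : 1 ≤ δ * Real.exp K)
    (hp : 8 * Real.log (16 / δ) ≤ Fintype.card ι * Q.real G) :
    (Measure.pi fun _ : ι => Q).real
      {z | deviationRadius (Fintype.card ι * Q.real G) K <
        |hitCount G z - Fintype.card ι * Q.real G|} ≤ δ / 8 := by
  have htraces : ∀ w : ι ⊕ ι → Z, traces {G} w = {w ⁻¹' G} := fun w => Set.image_singleton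
  have hnull : ∀ A, NullMeasurableSet {w | A ∈ traces {G} w}
      (Measure.pi fun _ : ι ⊕ ι => Q) := by
    intro A
    have hset : {w : ι ⊕ ι → Z | A ∈ traces {G} w} = ⋂ i, {w | i ∈ A ↔ w i ∈ G} := by
      ext w
      simp [htraces, Set.ext_iff]
    rw [hset]
    exact (MeasurableSet.iInter fun i =>
      (MeasurableSet.const _).iff (measurable_pi_apply i hG)).nullMeasurableSet
  have h := measure_deviationEvent_le_of_growth Q hG (𝓕 := {G}) (by simpa using hG) (by simp)
    hnull (fun w => by simpa [htraces] using hδK) hδ hδ1 hK hp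
  simpa [deviationEvent] using h

end UniformDeviation

section Growth

theorem exp_one_le_two_mul_div_pow {d n : ℕ} (hd : 0 < d) (hdn : d ≤ 2 * n) :
    Real.exp 1 ≤ (2 * Real.exp 1 * n / d) ^ d := by
  have hdn' : (d : ℝ) ≤ 2 * n := by exact_mod_cast hdn
  have hbase : Real.exp 1 ≤ 2 * Real.exp 1 * n / d := by
    rw [le_div_iff₀ (by positivity)]
    nlinarith [Real.exp_pos 1]
  exact hbase.trans (le_self_pow₀ ((Real.one_le_exp zero_le_one).trans hbase) hd.ne')

theorem one_le_of_exp_one_le_mul_exp {δ K : ℝ} (hδ1 : δ ≤ 1) (h : Real.exp 1 ≤ δ * Real.exp K) :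
    1 ≤ K :=
  Real.exp_le_exp.1 (h.trans (mul_le_of_le_one_left (Real.exp_pos K).le hδ1))

end Growth

section Disagreement

variable {ι Z : Type*} {X : Type u} {π : Z → X} {b : Z → Bool} {G : Set Z}
  {H : Set (Classifier X)}

/-- The points of `G` at which the label given by `h`, which only sees the feature `π`, differs
from the label `b`. Every event of the objective is of this form: for the errors, `b` is the label
and `G` is everything, and for the true positives of a group, `b = false` and `G` is the event that
the label is positive and the group is the given one. -/
def disagreement (π : Z → X) (b : Z → Bool) (G : Set Z) (h : Classifier X) : Set Z :=
  {z | z ∈ G ∧ h (π z) ≠ b z}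

theorem disagreement_subset (h : Classifier X) : disagreement π b G h ⊆ G := fun _ hz => hz.1

/-- The trace of a disagreement set on a tuple, expressed by the pattern `c` of the classifier on
this tuple. -/
def patternTrace (b : Z → Bool) (G : Set Z) (w : ι → Z) (c : ι → Bool) : Set ι :=
  {i | w i ∈ G ∧ c i ≠ b (w i)}

theorem traces_disagreement (w : ι → Z) :
    traces (disagreement π b G '' H) w = patternTrace b G w '' patterns H (π ∘ w) := by
  rw [traces, patterns, Set.image_image, Set.image_image]
  rfl

theorem ncard_traces_disagreement_le [Fintype ι] {d : ℕ} (hd : vcDim H ≤ d) (hd0 : 0 < d)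
    (hdι : d ≤ Fintype.card ι) (w : ι → Z) :
    ((traces (disagreement π b G '' H) w).ncard : ℝ) ≤
      (Real.exp 1 * Fintype.card ι / d) ^ d := by
  rw [traces_disagreement]
  exact (Nat.cast_le.2 (Set.ncard_image_le (Set.toFinite _))).trans
    (ncard_patterns_le hd hd0 hdι _)

variable [MeasurableSpace Z]

theorem measurableSet_mem_patternTrace (hb : Measurable b) (hG : MeasurableSet G) (c : ι → Bool)
    (i : ι) : MeasurableSet {w : ι → Z | i ∈ patternTrace b G w c} :=
  (hG.inter (measurableSet_eq_fun (measurable_const (a := c i)) hb).compl).preimage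
    (measurable_pi_apply i)

variable [MeasurableSpace X]

theorem measurableSet_disagreement (hπ : Measurable π) (hb : Measurable b)
    (hG : MeasurableSet G) {h : Classifier X} (hh : Measurable h) :
    MeasurableSet (disagreement π b G h) :=
  hG.inter (measurableSet_eq_fun (hh.comp hπ) hb).compl

variable [Fintype ι]

theorem nullMeasurableSet_mem_patterns {ν : Measure X} [SigmaFinite ν]
    (hH : ∀ (m : ℕ) (c : Fin m → Bool),
      NullMeasurableSet {x : Fin m → X | ∃ h ∈ H, ∀ i, h (x i) = c i} (Measure.pi fun _ => ν))
    (c : ι → Bool) : NullMeasurableSet {x : ι → X | c ∈ patterns H x} (Measure.pi fun _ => ν) := by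
  have e := Fintype.equivFin ι
  have hmp := measurePreserving_piCongrLeft (α := fun _ : Fin (Fintype.card ι) => X)
    (fun _ => ν) e
  convert (hH _ (c ∘ e.symm)).preimage hmp.quasiMeasurePreserving using 1
  ext x
  refine exists_congr fun h => and_congr_right fun _ => ?_
  simp only [funext_iff, ← e.forall_congr_right, MeasurableEquiv.coe_piCongrLeft,
    Equiv.piCongrLeft_apply_apply, Function.comp_apply, e.symm_apply_apply]

variable (Q : Measure Z) [IsProbabilityMeasure Q]

theorem nullMeasurableSet_mem_traces_disagreement (hπ : Measurable π) (hb : Measurable b)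
    (hG : MeasurableSet G)
    (hH : ∀ (m : ℕ) (c : Fin m → Bool),
      NullMeasurableSet {x : Fin m → X | ∃ h ∈ H, ∀ i, h (x i) = c i}
        (Measure.pi fun _ => Q.map π)) (A : Set ι) :
    NullMeasurableSet {w | A ∈ traces (disagreement π b G '' H) w}
      (Measure.pi fun _ : ι => Q) := by
  classical
  have := Measure.isProbabilityMeasure_map (μ := Q) hπ.aemeasurable
  have hset : {w : ι → Z | A ∈ traces (disagreement π b G '' H) w} =
      ⋃ c : ι → Bool, (fun w => π ∘ w) ⁻¹' {x | c ∈ patterns H x} ∩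
        ⋂ i, {w | i ∈ patternTrace b G w c ↔ i ∈ A} := by
    ext w
    simp [traces_disagreement, Set.ext_iff]
  rw [hset]
  have hπmp : MeasurePreserving (fun w : ι → Z => π ∘ w) (Measure.pi fun _ => Q)
      (Measure.pi fun _ => Q.map π) :=
    measurePreserving_pi _ _ fun _ => ⟨hπ, rfl⟩
  refine NullMeasurableSet.iUnion fun c => NullMeasurableSet.inter ?_ ?_
  · exact (nullMeasurableSet_mem_patterns hH c).preimage hπmp.quasiMeasurePreserving
  · exact (MeasurableSet.iInter fun i =>
      (measurableSet_mem_patternTrace hb hG c i).iff (.const (i ∈ A))).nullMeasurableSet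

theorem measure_lt_abs_hitCount_disagreement_sub_le (hπ : Measurable π) (hb : Measurable b)
    (hG : MeasurableSet G) (hHm : ∀ h ∈ H, Measurable h)
    (hH : ∀ (m : ℕ) (c : Fin m → Bool),
      NullMeasurableSet {x : Fin m → X | ∃ h ∈ H, ∀ i, h (x i) = c i}
        (Measure.pi fun _ => Q.map π))
    {d : ℕ} (hd : vcDim H ≤ d) (hd0 : 0 < d) (hdι : d ≤ 2 * Fintype.card ι)
    {δ K : ℝ} (hδ : 0 < δ) (hδ1 : δ < 1)
    (hNK : (2 * Real.exp 1 * Fintype.card ι / d) ^ d ≤ δ * Real.exp K)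
    (hp : 8 * Real.log (16 / δ) ≤ Fintype.card ι * Q.real G) :
    (Measure.pi fun _ : ι => Q).real
      {z | ∃ h ∈ H, deviationRadius (Fintype.card ι * Q.real G) K <
        |hitCount (disagreement π b G h) z -
          Fintype.card ι * Q.real (disagreement π b G h)|} ≤ δ / 8 := by
  have hK : 1 ≤ K :=
    one_le_of_exp_one_le_mul_exp hδ1.le ((exp_one_le_two_mul_div_pow hd0 hdι).trans hNK)
  have hN : ∀ w : ι ⊕ ι → Z,
      ((traces (disagreement π b G '' H) w).ncard : ℝ) ≤ δ * Real.exp K := by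
    intro w
    refine (ncard_traces_disagreement_le hd hd0 (by simpa [two_mul] using hdι) w).trans
      (le_of_eq_of_le ?_ hNK)
    rw [Fintype.card_sum, Nat.cast_add]
    ring_nf
  simpa only [deviationEvent, Set.exists_mem_image] using
    measure_deviationEvent_le_of_growth Q hG (𝓕 := disagreement π b G '' H)
      (Set.forall_mem_image.2 fun h hh => measurableSet_disagreement hπ hb hG (hHm h hh))
      (Set.forall_mem_image.2 fun h _ => disagreement_subset h)
      (nullMeasurableSet_mem_traces_disagreement Q hπ hb hG hH) hN hδ hδ1 hK hp

end Disagreement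

section Corruption

variable {ι Y : Type*} [Fintype ι]

theorem hitCount_eq_card (F : Set Y) [DecidablePred (· ∈ F)] (z : ι → Y) :
    hitCount F z = ((Finset.univ.filter fun i => z i ∈ F).card : ℝ) := by
  simp [hitCount, Set.indicator_apply]

theorem hitCount_mono {F F' : Set Y} (h : F ⊆ F') (z : ι → Y) : hitCount F z ≤ hitCount F' z :=
  Finset.sum_le_sum fun _ _ => Set.indicator_le_indicator_of_subset h (fun _ => zero_le_one) _

theorem hitCount_union {F F' : Set Y} (h : Disjoint F F') (z : ι → Y) :
    hitCount (F ∪ F') z = hitCount F z + hitCount F' z := by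
  rw [hitCount, hitCount, hitCount, ← Finset.sum_add_distrib, Set.indicator_union_of_disjoint h]

theorem card_filter_fst_mem_eq (A : Set Y) [DecidablePred (· ∈ A)] (z : ι → Y × Bool) :
    ((Finset.univ.filter fun i => (z i).1 ∈ A).card : ℝ) =
      hitCount (A ×ˢ {false}) z + hitCount (A ×ˢ {true}) z := by
  classical
  rw [← hitCount_union (by simp [Set.disjoint_prod]), ← Set.prod_union, hitCount_eq_card]
  congr 2
  ext i
  simp

/-- The marked points, in a space `Y × Bool` of points with marks. -/
def marked (Y : Type*) : Set (Y × Bool) := Set.univ ×ˢ {true}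

theorem hitCount_prod_true_add_le {A B : Set Y} (h : Disjoint A B) (z : ι → Y × Bool) :
    hitCount (A ×ˢ {true}) z + hitCount (B ×ˢ {true}) z ≤ hitCount (marked Y) z := by
  rw [← hitCount_union (Set.disjoint_prod.2 (.inl h)), ← Set.union_prod]
  exact hitCount_mono (Set.prod_mono_left (Set.subset_univ _)) z

/-- The marked sample `z'` arises from `z` by an arbitrary change of the marked points, the marks
being kept. -/
def IsCorruption (z z' : ι → Y × Bool) : Prop :=
  ∀ i, (z' i).2 = (z i).2 ∧ ((z i).2 = false → z' i = z i)

namespace IsCorruption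

variable {z z' : ι → Y × Bool}

theorem hitCount_prod_false (hz : IsCorruption z z') (A : Set Y) :
    hitCount (A ×ˢ {false}) z' = hitCount (A ×ˢ {false}) z := by
  classical
  refine Finset.sum_congr rfl fun i _ => ?_
  cases hm : (z i).2 with
  | false => rw [(hz i).2 hm]
  | true => simp [(hz i).1, hm]

theorem hitCount_marked (hz : IsCorruption z z') :
    hitCount (marked Y) z' = hitCount (marked Y) z := by
  classical
  refine Finset.sum_congr rfl fun i _ => ?_
  simp [Set.indicator_apply, marked, (hz i).1]

theorem abs_hitCount_sub_le (hz : IsCorruption z z') (F : Set (Y × Bool)) :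
    |hitCount F z' - hitCount F z| ≤ hitCount (marked Y) z := by
  classical
  rw [hitCount, hitCount, ← Finset.sum_sub_distrib]
  refine (Finset.abs_sum_le_sum_abs _ _).trans (Finset.sum_le_sum fun i _ => ?_)
  cases hm : (z i).2 with
  | false => simp [(hz i).2 hm, marked, hm]
  | true =>
    simp only [Set.indicator_apply, Pi.one_apply, marked, Set.mem_prod, Set.mem_univ, true_and,
      Set.mem_singleton_iff, hm, if_true]
    split_ifs <;> norm_num

end IsCorruption

end Corruption

section CorruptedRates

variable {X : Type u} {n : ℕ}

/-- The examples misclassified by `h`. -/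
def errors (h : Classifier X) : Set (Example X) := {z | h z.1 ≠ z.2.2}

/-- The true positives of `h` in group `a`. -/
def truePositives (h : Classifier X) (a : Bool) : Set (Example X) :=
  {z | h z.1 = true ∧ z ∈ posGroup X a}

theorem truePositives_subset (h : Classifier X) (a : Bool) :
    truePositives h a ⊆ posGroup X a := fun _ hz => hz.2

theorem disjoint_posGroup : Disjoint (posGroup X false) (posGroup X true) :=
  Set.disjoint_left.2 fun _ h0 h1 => Bool.false_ne_true (h0.1.symm.trans h1.1)

theorem empRisk_eq_hitCount_div (h : Classifier X) (z : Fin n → Example X × Bool) :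
    empRisk (fun i => (z i).1) h = hitCount (errors h ×ˢ Set.univ) z / n := by
  classical
  rw [empRisk, hitCount_eq_card]
  simp [errors]

theorem empTruePosRate_eq_hitCount_div (h : Classifier X) (a : Bool)
    (z : Fin n → Example X × Bool) :
    empTruePosRate (fun i => (z i).1) h a =
      (hitCount (truePositives h a ×ˢ {false}) z + hitCount (truePositives h a ×ˢ {true}) z) /
        (hitCount (posGroup X a ×ˢ {false}) z + hitCount (posGroup X a ×ˢ {true}) z) := by
  classical
  rw [← card_filter_fst_mem_eq, ← card_filter_fst_mem_eq]
  unfold empTruePosRate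
  congr 3 <;> ext i <;> simp only [Finset.mem_filter] <;> rfl

theorem abs_add_div_add_sub_div_le {N c j k : ℝ} (hN : 0 ≤ N) (hNc : N ≤ c) (hc : 0 < c)
    (hj : 0 ≤ j) (hjk : j ≤ k) : |(N + j) / (c + k) - N / c| ≤ k / (c + k) := by
  have hck : 0 < c + k := by linarith
  have hdiff : (N + j) / (c + k) - N / c = (j - N / c * k) / (c + k) := by
    field_simp
    ring
  have hratio : N / c ≤ 1 := (div_le_one hc).2 hNc
  have hratio0 : 0 ≤ N / c := by positivity
  rw [hdiff, abs_div, abs_of_pos hck]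
  gcongr
  rw [abs_le]
  constructor <;> nlinarith

variable {z z' : Fin n → Example X × Bool}

theorem IsCorruption.abs_empRisk_sub_le (hz : IsCorruption z z') (h : Classifier X) :
    |empRisk (fun i => (z' i).1) h - hitCount (errors h ×ˢ Set.univ) z / n| ≤
      hitCount (marked (Example X)) z / n := by
  rw [empRisk_eq_hitCount_div, ← sub_div, abs_div, Nat.abs_cast]
  gcongr
  exact hz.abs_hitCount_sub_le _

theorem IsCorruption.abs_empTruePosRate_sub_le (hz : IsCorruption z z') (h : Classifier X)
    {a : Bool} (hpos : 0 < hitCount (posGroup X a ×ˢ {false}) z) :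
    |empTruePosRate (fun i => (z' i).1) h a -
        hitCount (truePositives h a ×ˢ {false}) z / hitCount (posGroup X a ×ˢ {false}) z| ≤
      hitCount (posGroup X a ×ˢ {true}) z' /
        (hitCount (posGroup X a ×ˢ {false}) z + hitCount (posGroup X a ×ˢ {true}) z') := by
  rw [empTruePosRate_eq_hitCount_div, hz.hitCount_prod_false, hz.hitCount_prod_false]
  exact abs_add_div_add_sub_div_le (hitCount_nonneg _ _)
    (hitCount_mono (Set.prod_mono_left (truePositives_subset h a)) z) hpos (hitCount_nonneg _ _)
    (hitCount_mono (Set.prod_mono_left (truePositives_subset h a)) z')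

theorem div_add_le_tangent {c m x : ℝ} (hc : 0 < c) (hm : 0 ≤ m) (hx : 0 ≤ x) :
    x / (c + x) ≤ m / (c + m) + c * (x - m) / (c + m) ^ 2 := by
  have hgap : m / (c + m) + c * (x - m) / (c + m) ^ 2 - x / (c + x) =
      c * (x - m) ^ 2 / ((c + m) ^ 2 * (c + x)) := by
    field_simp
    ring
  have : 0 ≤ c * (x - m) ^ 2 / ((c + m) ^ 2 * (c + x)) := by positivity
  linarith

-- By concavity of `x ↦ x / (c + x)`, an even split of the marked points is the worst one.
theorem div_add_add_div_add_le {c c₀ c₁ k₀ k₁ m : ℝ} (hc : 0 < c) (hc₀ : c ≤ c₀) (hc₁ : c ≤ c₁)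
    (hk₀ : 0 ≤ k₀) (hk₁ : 0 ≤ k₁) (hk : k₀ + k₁ ≤ 2 * m) :
    k₀ / (c₀ + k₀) + k₁ / (c₁ + k₁) ≤ 2 * (m / (c + m)) := by
  have hm : 0 ≤ m := by linarith
  have hmono₀ : k₀ / (c₀ + k₀) ≤ k₀ / (c + k₀) := by gcongr
  have hmono₁ : k₁ / (c₁ + k₁) ≤ k₁ / (c + k₁) := by gcongr
  have hslopes : c * (k₀ - m) / (c + m) ^ 2 + c * (k₁ - m) / (c + m) ^ 2 ≤ 0 := by
    rw [← add_div, ← mul_add]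
    exact div_nonpos_of_nonpos_of_nonneg
      (mul_nonpos_of_nonneg_of_nonpos hc.le (by linarith)) (by positivity)
  linarith [div_add_le_tangent hc hm hk₀, div_add_le_tangent hc hm hk₁]

theorem shift_le_irreducibleOpp {α p N c₀ c₁ k₀ k₁ : ℝ} (hα' : α < 1 / 2)
    (hp : 0 < p) (hN : 0 < N) (hc₀ : N * ((1 - α) * p) / 2 ≤ c₀)
    (hc₁ : N * ((1 - α) * p) / 2 ≤ c₁) (hk₀ : 0 ≤ k₀) (hk₁ : 0 ≤ k₁)
    (hk : k₀ + k₁ ≤ 3 / 2 * (N * α)) :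
    k₀ / (c₀ + k₀) + k₁ / (c₁ + k₁) ≤ irreducibleOpp α p := by
  have hNp : 0 < N * p := by positivity
  have hα : 0 ≤ α := by
    by_contra! hneg
    nlinarith
  have hquarter : N * p / 4 ≤ N * ((1 - α) * p) / 2 := by nlinarith
  refine (div_add_add_div_add_le (c := N * p / 4) (m := 3 / 4 * (N * α)) (by positivity)
    (by linarith) (by linarith) hk₀ hk₁ (by linarith)).trans_eq ?_
  rw [irreducibleOpp]
  field_simp

end CorruptedRates

section Ratios

theorem abs_div_sub_div_le {N W q p n t : ℝ} (hnp : 0 < n * p) (hq : 0 ≤ q)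
    (hqp : q ≤ p) (hN : |N - n * q| ≤ t) (hW : |W - n * p| ≤ t) (hWp : n * p / 2 ≤ W) :
    |N / W - q / p| ≤ 4 * t / (n * p) := by
  have hW0 : 0 < W := by linarith
  have hp : p ≠ 0 := right_ne_zero_of_mul hnp.ne'
  have hp0 : 0 ≤ p := hq.trans hqp
  have hdiff : N / W - q / p = ((N - n * q) - q / p * (W - n * p)) / W := by
    field_simp
    ring
  have hratio : q / p ≤ 1 := div_le_one_of_le₀ hqp hp0
  have hnum : |(N - n * q) - q / p * (W - n * p)| ≤ 2 * t := by
    rw [two_mul]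
    refine (abs_sub _ _).trans (add_le_add hN ?_)
    rw [abs_mul, abs_of_nonneg (div_nonneg hq hp0)]
    exact (mul_le_of_le_one_left (abs_nonneg _) hratio).trans hW
  have ht : 0 ≤ 2 * t := (abs_nonneg _).trans hnum
  rw [hdiff, abs_div, abs_of_pos hW0]
  calc |(N - n * q) - q / p * (W - n * p)| / W ≤ 2 * t / (n * p / 2) := by gcongr
    _ = 4 * t / (n * p) := by
      field_simp
      ring

theorem four_mul_deviationRadius_div_le {n p P R : ℝ} (hn : 0 < n) (hP : 0 < P)
    (hp : P / 2 ≤ p) (hR : 0 ≤ R) :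
    4 * deviationRadius (n * p) (n * R) / (n * p) ≤ 80 * √(R / P) := by
  have hp0 : 0 < p := by linarith
  have hratio : R / p ≤ 2 * (R / P) := by
    calc R / p ≤ R / (P / 2) := by gcongr
      _ = 2 * (R / P) := by field_simp
  have hradius : deviationRadius (n * p) (n * R) ≤ 20 * √(R / P) * (n * p) := by
    rw [deviationRadius, Real.sqrt_le_left (by positivity), mul_pow, mul_pow,
      Real.sq_sqrt (by positivity)]
    calc 192 * (n * p) * (n * R) = 192 * (R / p) * (n * p) ^ 2 := by field_simp
      _ ≤ 20 ^ 2 * (R / P) * (n * p) ^ 2 := by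
        gcongr ?_ * _
        linarith [div_nonneg hR hP.le]
  rw [div_le_iff₀ (by positivity)]
  linarith

theorem deviationRadius_div_le {n R : ℝ} (hn : 0 < n) (hR : 0 ≤ R) :
    deviationRadius n (n * R) / n ≤ 14 * √R := by
  rw [div_le_iff₀ hn, deviationRadius, Real.sqrt_le_left (by positivity), mul_pow, mul_pow,
    Real.sq_sqrt hR]
  nlinarith [mul_nonneg (sq_nonneg n) hR]

end Ratios

section MarkedExamples

theorem isProbabilityMeasure_markLaw {α : ℝ} (hα : 0 ≤ α) (hα1 : α ≤ 1) :
    IsProbabilityMeasure (markLaw α) := by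
  constructor
  simp only [markLaw, Measure.coe_add, Measure.coe_smul, Pi.add_apply, Pi.smul_apply,
    measure_univ, smul_eq_mul, mul_one]
  rw [← ENNReal.ofReal_add hα (sub_nonneg.2 hα1), add_sub_cancel, ENNReal.ofReal_one]

theorem markLaw_real_true {α : ℝ} (hα : 0 ≤ α) : (markLaw α).real {true} = α := by
  simp [markLaw, measureReal_def, hα]

theorem markLaw_real_false {α : ℝ} (hα1 : α ≤ 1) : (markLaw α).real {false} = 1 - α := by
  simp [markLaw, measureReal_def, hα1]

variable {X : Type u}

/-- The input of an example that carries a mark. -/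
def markedInput (z : Example X × Bool) : X := z.1.1

theorem errors_prod_univ_eq_disagreement (h : Classifier X) :
    errors h ×ˢ Set.univ = disagreement markedInput (fun z => z.1.2.2) Set.univ h := by
  ext z
  simp [errors, disagreement, markedInput]

theorem truePositives_prod_false_eq_disagreement (h : Classifier X) (a : Bool) :
    truePositives h a ×ˢ {false} =
      disagreement markedInput (fun _ => false) (posGroup X a ×ˢ {false}) h := by
  ext z
  simp only [truePositives, disagreement, markedInput, Set.mem_prod, Set.mem_ofPred_eq, ne_eq,
    Bool.not_eq_false]
  tauto

variable [MeasurableSpace X]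

theorem measurable_markedInput : Measurable (markedInput : Example X × Bool → X) :=
  measurable_fst.comp measurable_fst

theorem measurableSet_posGroup (a : Bool) : MeasurableSet (posGroup X a) :=
  (measurableSet_eq_fun (by fun_prop) measurable_const).inter
    (measurableSet_eq_fun (by fun_prop) measurable_const)

theorem measurableSet_posGroup_prod_false (a : Bool) :
    MeasurableSet (posGroup X a ×ˢ ({false} : Set Bool)) :=
  (measurableSet_posGroup a).prod (measurableSet_singleton _)

variable (P : Measure (Example X))

theorem truePosRate_eq_div (h : Classifier X) (a : Bool) :
    truePosRate P h a = P.real (truePositives h a) / posRate P a := by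
  rw [truePosRate, measureReal_def, ProbabilityTheory.cond_apply (measurableSet_posGroup a),
    ENNReal.toReal_mul, ENNReal.toReal_inv, div_eq_inv_mul, Set.inter_comm]
  rfl

variable {α : ℝ}

theorem real_prod_markLaw_prod_false (hα : 0 ≤ α) (hα1 : α ≤ 1) (A : Set (Example X)) :
    (P.prod (markLaw α)).real (A ×ˢ {false}) = (1 - α) * P.real A := by
  have := isProbabilityMeasure_markLaw hα hα1
  rw [measureReal_prod_prod, markLaw_real_false hα1, mul_comm]

theorem real_prod_markLaw_prod_univ (hα : 0 ≤ α) (hα1 : α ≤ 1) (A : Set (Example X)) :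
    (P.prod (markLaw α)).real (A ×ˢ Set.univ) = P.real A := by
  have := isProbabilityMeasure_markLaw hα hα1
  rw [measureReal_prod_prod, probReal_univ, mul_one]

theorem map_markedInput_prod_markLaw (hα : 0 ≤ α) (hα1 : α ≤ 1) :
    (P.prod (markLaw α)).map markedInput = P.map Prod.fst := by
  have := isProbabilityMeasure_markLaw hα hα1
  change (P.prod (markLaw α)).map (Prod.fst ∘ Prod.fst) = _
  rw [← Measure.map_map measurable_fst measurable_fst, Measure.map_fst_prod, measure_univ,
    one_smul]

theorem real_prod_markLaw_marked [IsProbabilityMeasure P] (hα : 0 ≤ α) (hα1 : α ≤ 1) :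
    (P.prod (markLaw α)).real (marked (Example X)) = α := by
  have := isProbabilityMeasure_markLaw hα hα1
  rw [marked, measureReal_prod_prod, probReal_univ, one_mul, markLaw_real_true hα]

end MarkedExamples

section HitCountTails

variable {ι Z : Type*} [Fintype ι] [MeasurableSpace Z] (Q : Measure Z) [IsProbabilityMeasure Q]
  {F : Set Z}

theorem exp_neg_le_of_log_le {c δ x : ℝ} (hc : 0 < c) (hδ : 0 < δ) (hx : Real.log (c / δ) ≤ x) :
    Real.exp (-x) ≤ δ / c := by
  rw [Real.exp_neg, ← inv_div]
  gcongr
  exact (Real.log_le_iff_le_exp (by positivity)).1 hx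

theorem measure_three_halves_lt_hitCount_le (hF : MeasurableSet F) {δ : ℝ} (hδ : 0 < δ)
    (hn : 12 * Real.log (12 / δ) ≤ Fintype.card ι * Q.real F) :
    (Measure.pi fun _ : ι => Q).real
      {z | 3 / 2 * (Fintype.card ι * Q.real F) < hitCount F z} ≤ δ / 12 := by
  refine le_trans (measureReal_mono fun z hz => ?_)
    ((measure_hitCount_ge_le_exp (ι := ι) Q hF (ε := 1 / 2) (by norm_num) (by norm_num)).trans
      (exp_neg_le_of_log_le (by norm_num) hδ (by linarith)))
  have hz' : 3 / 2 * (Fintype.card ι * Q.real F) < hitCount F z := hz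
  exact le_of_eq_of_le (by norm_num) hz'.le

theorem measure_hitCount_lt_half_le (hF : MeasurableSet F) {δ : ℝ} (hδ : 0 < δ)
    (hn : 8 * Real.log (16 / δ) ≤ Fintype.card ι * Q.real F) :
    (Measure.pi fun _ : ι => Q).real
      {z | hitCount F z < Fintype.card ι * Q.real F / 2} ≤ δ / 16 := by
  refine le_trans (measureReal_mono fun z hz => ?_)
    ((measure_hitCount_le_le_exp (ι := ι) Q hF (ε := 1 / 2) (by norm_num)).trans
      (exp_neg_le_of_log_le (by norm_num) hδ (by linarith)))
  have hz' : hitCount F z < Fintype.card ι * Q.real F / 2 := hz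
  exact hz'.le.trans_eq (by ring)

theorem measure_hitCount_pos_eq_zero (hF : MeasurableSet F) (hQ : Q.real F = 0) :
    (Measure.pi fun _ : ι => Q).real {z | 0 < hitCount F z} = 0 := by
  classical
  have hcheb := measure_abs_hitCount_sub_ge_le (ι := ι) Q hF one_pos
  rw [hQ, mul_zero, zero_div] at hcheb
  refine le_antisymm ((measureReal_mono fun z hz => ?_).trans hcheb) measureReal_nonneg
  have hpos : 0 < hitCount F z := hz
  rw [hitCount_eq_card, Nat.cast_pos] at hpos
  rw [Set.mem_ofPred_eq, sub_zero, hitCount_eq_card, Nat.abs_cast]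
  exact_mod_cast hpos

end HitCountTails

section GoodSample

variable {X : Type u} [MeasurableSpace X]

/-- The law of a clean sample of size `n` with its marks. -/
noncomputable abbrev markedSampleLaw (P : Measure (Example X)) (α : ℝ) (n : ℕ) :
    Measure (Fin n → Example X × Bool) :=
  Measure.pi fun _ => P.prod (markLaw α)

/-- The properties of a marked sample that control the true positive rates in group `a`: the group
has at least half of the expected number of unmarked points, and the numbers of its unmarked points
and of those of them that are classified as positive are close to their expectations. -/
structure GoodGroup (P : Measure (Example X)) (H : Set (Classifier X)) (α K : ℝ) {n : ℕ}
    (z : Fin n → Example X × Bool) (a : Bool) : Prop where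
  large : n * ((1 - α) * posRate P a) / 2 ≤ hitCount (posGroup X a ×ˢ {false}) z
  group : |hitCount (posGroup X a ×ˢ {false}) z - n * ((1 - α) * posRate P a)| ≤
    deviationRadius (n * ((1 - α) * posRate P a)) K
  positive : ∀ h ∈ H, |hitCount (truePositives h a ×ˢ {false}) z -
    n * ((1 - α) * P.real (truePositives h a))| ≤ deviationRadius (n * ((1 - α) * posRate P a)) K

/-- The properties of a marked sample from which the excess bound follows whatever the adversary
does: few marks, empirical risks close to the risks, and both groups good. -/
structure GoodSample (P : Measure (Example X)) (H : Set (Classifier X)) (α K : ℝ) {n : ℕ}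
    (z : Fin n → Example X × Bool) : Prop where
  marks : hitCount (marked (Example X)) z ≤ 3 / 2 * (n * α)
  error : ∀ h ∈ H, |hitCount (errors h ×ˢ Set.univ) z - n * risk P h| ≤ deviationRadius n K
  groups : ∀ a, GoodGroup P H α K z a

variable (P : Measure (Example X)) [IsProbabilityMeasure P] {H : Set (Classifier X)} {α δ K : ℝ}
  {d n : ℕ}

theorem measure_lt_hitCount_marked_le (hα : 0 ≤ α) (hα1 : α ≤ 1) (hδ : 0 < δ)
    (hn : 12 * Real.log (12 / δ) / α ≤ n) :
    (markedSampleLaw P α n).real {z | 3 / 2 * (n * α) < hitCount (marked (Example X)) z} ≤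
      δ / 12 := by
  have := isProbabilityMeasure_markLaw hα hα1
  have hQ := real_prod_markLaw_marked P hα hα1
  have hmarked : MeasurableSet (marked (Example X)) :=
    MeasurableSet.univ.prod (measurableSet_singleton true)
  rcases hα.eq_or_lt with rfl | hpos
  · have hzero := measure_hitCount_pos_eq_zero (ι := Fin n) _ hmarked hQ
    simp only [mul_zero, hzero]
    positivity
  · rw [div_le_iff₀ hpos] at hn
    have htail := measure_three_halves_lt_hitCount_le (ι := Fin n) _ hmarked hδ
      (by rwa [hQ, Fintype.card_fin])
    rwa [hQ, Fintype.card_fin] at htail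

theorem measure_not_goodGroup_le (hd : vcDim H ≤ d) (hd0 : 0 < d) (hdn : d ≤ 2 * n)
    (hH : MeasurableClass P H) (hα : 0 ≤ α) (hα1 : α ≤ 1) (hδ : 0 < δ) (hδ1 : δ < 1)
    (hNK : (2 * Real.exp 1 * n / d) ^ d ≤ δ * Real.exp K)
    (a : Bool) (hn : 8 * Real.log (16 / δ) ≤ n * ((1 - α) * posRate P a)) :
    (markedSampleLaw P α n).real {z | ¬ GoodGroup P H α K z a} ≤ 5 * δ / 16 := by
  have hgrowth := (exp_one_le_two_mul_div_pow hd0 hdn).trans hNK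
  have := isProbabilityMeasure_markLaw hα hα1
  set Q := P.prod (markLaw α)
  have hG := measurableSet_posGroup_prod_false (X := X) a
  have hQ : Q.real (posGroup X a ×ˢ {false}) = (1 - α) * posRate P a :=
    real_prod_markLaw_prod_false P hα hα1 _
  have hn' : 8 * Real.log (16 / δ) ≤ Fintype.card (Fin n) * Q.real (posGroup X a ×ˢ {false}) := by
    rwa [hQ, Fintype.card_fin]
  have hlarge := measure_hitCount_lt_half_le (ι := Fin n) Q hG hδ hn'
  have hgroup := measure_lt_abs_hitCount_sub_le (ι := Fin n) Q hG hδ hδ1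
    (one_le_of_exp_one_le_mul_exp hδ1.le hgrowth)
    ((Real.one_le_exp zero_le_one).trans hgrowth) hn'
  have hpositive := measure_lt_abs_hitCount_disagreement_sub_le (ι := Fin n) Q
    measurable_markedInput (b := fun _ => false) measurable_const hG hH.1
    (by rw [map_markedInput_prod_markLaw P hα hα1]; exact hH.2) hd hd0
    (by rwa [Fintype.card_fin]) hδ hδ1 (by rwa [Fintype.card_fin]) hn'
  simp only [← truePositives_prod_false_eq_disagreement, hQ, Fintype.card_fin, Q,
    real_prod_markLaw_prod_false P hα hα1] at hlarge hgroup hpositive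
  refine (measureReal_mono fun z hz => ?_).trans ((measureReal_union_le _ _).trans
    ((add_le_add hlarge ((measureReal_union_le _ _).trans (add_le_add hgroup hpositive))).trans
      (by linarith)))
  contrapose! hz
  simp only [Set.mem_union, Set.mem_ofPred_eq, not_or, not_lt, not_exists, not_and] at hz
  exact not_not.2 ⟨hz.1, hz.2.1, hz.2.2⟩

theorem measure_lt_abs_hitCount_errors_sub_le (hd : vcDim H ≤ d) (hd0 : 0 < d) (hdn : d ≤ 2 * n)
    (hH : MeasurableClass P H) (hα : 0 ≤ α) (hα1 : α ≤ 1) (hδ : 0 < δ) (hδ1 : δ < 1)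
    (hNK : (2 * Real.exp 1 * n / d) ^ d ≤ δ * Real.exp K)
    (hn : 8 * Real.log (16 / δ) ≤ n) :
    (markedSampleLaw P α n).real {z | ∃ h ∈ H,
      deviationRadius n K < |hitCount (errors h ×ˢ Set.univ) z - n * risk P h|} ≤ δ / 8 := by
  have := isProbabilityMeasure_markLaw hα hα1
  have hdev := measure_lt_abs_hitCount_disagreement_sub_le (ι := Fin n) (P.prod (markLaw α))
    measurable_markedInput (b := fun z => z.1.2.2) (by fun_prop) MeasurableSet.univ hH.1
    (by rw [map_markedInput_prod_markLaw P hα hα1]; exact hH.2) hd hd0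
    (by rwa [Fintype.card_fin]) hδ hδ1 (by rwa [Fintype.card_fin])
    (by rwa [Fintype.card_fin, probReal_univ, mul_one])
  simp only [← errors_prod_univ_eq_disagreement, probReal_univ, mul_one, Fintype.card_fin,
    real_prod_markLaw_prod_univ P hα hα1] at hdev
  exact hdev

theorem measure_not_goodSample_lt (hd : vcDim H ≤ d) (hd0 : 0 < d) (hdn : d ≤ 2 * n)
    (hH : MeasurableClass P H) (hα : 0 ≤ α) (hα1 : α ≤ 1) (hδ : 0 < δ) (hδ1 : δ < 1)
    (hNK : (2 * Real.exp 1 * n / d) ^ d ≤ δ * Real.exp K)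
    (hmarks : 12 * Real.log (12 / δ) / α ≤ n)
    (hgroups : ∀ a, 8 * Real.log (16 / δ) ≤ n * ((1 - α) * posRate P a)) :
    (markedSampleLaw P α n).real {z | ¬ GoodSample P H α K z} < δ := by
  have := isProbabilityMeasure_markLaw hα hα1
  have hn : 8 * Real.log (16 / δ) ≤ n :=
    (hgroups false).trans (mul_le_of_le_one_right (Nat.cast_nonneg n)
      (mul_le_one₀ (by linarith) measureReal_nonneg measureReal_le_one))
  have hbad := measure_not_goodGroup_le P hd hd0 hdn hH hα hα1 hδ hδ1 hNK
  refine lt_of_le_of_lt ((measureReal_mono fun z hz => ?_).trans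
    ((measureReal_union_le _ _).trans (add_le_add
      (measure_lt_hitCount_marked_le P hα hα1 hδ hmarks) ((measureReal_union_le _ _).trans
        (add_le_add (measure_lt_abs_hitCount_errors_sub_le P hd hd0 hdn hH hα hα1 hδ hδ1 hNK hn)
          ((measureReal_union_le _ _).trans
            (add_le_add (hbad false (hgroups false)) (hbad true (hgroups true)))))))))
    (by linarith)
  contrapose! hz
  simp only [Set.mem_union, Set.mem_ofPred_eq, not_or, not_lt, not_exists, not_and, not_not] at hz
  exact not_not.2 ⟨hz.1, hz.2.1, Bool.forall_bool.2 hz.2.2⟩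

end GoodSample

section Closeness

variable {X : Type u} [MeasurableSpace X] {P : Measure (Example X)} {H : Set (Classifier X)}
  {α lam p R : ℝ} {n : ℕ} {z z' : Fin n → Example X × Bool} {h : Classifier X}

theorem GoodSample.abs_empRisk_sub_le (hz : GoodSample P H α (n * R) z) (hz' : IsCorruption z z')
    (hn : 0 < n) (hR : 0 ≤ R) (hh : h ∈ H) :
    |empRisk (fun i => (z' i).1) h - risk P h| ≤ 3 / 2 * α + 14 * √R := by
  have hn' : (0 : ℝ) < n := Nat.cast_pos.2 hn
  have hshift : |empRisk (fun i => (z' i).1) h - hitCount (errors h ×ˢ Set.univ) z / n| ≤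
      3 / 2 * α := by
    refine (hz'.abs_empRisk_sub_le h).trans ((div_le_iff₀ hn').2 ?_)
    linarith [hz.marks]
  have hdev : |hitCount (errors h ×ˢ Set.univ) z / n - risk P h| ≤ 14 * √R := by
    rw [div_sub' hn'.ne', abs_div, Nat.abs_cast]
    exact (div_le_div_of_nonneg_right (hz.error h hh) hn'.le).trans (deviationRadius_div_le hn' hR)
  exact (abs_sub_le _ _ _).trans (add_le_add hshift hdev)

theorem oppObjective_le_of_subsingleton {C δ : ℝ} {d : ℕ} {L : Learner X}
    (hsub : H.Subsingleton)
    (hlam : 0 ≤ lam) (hL : IsOppMinimizer H lam L) (hp : 0 ≤ p) (hα : 0 ≤ α) (hC : 0 ≤ C)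
    (hn : 0 < n) (S : Dataset X n) :
    oppObjective P lam (L n S) ≤
      (⨅ h : H, oppObjective P lam h) + oppExcess C α lam p d n δ := by
  have hmem := (hL n hn S).1
  have : Nonempty H := ⟨⟨_, hmem⟩⟩
  have hexcess : 0 ≤ oppExcess C α lam p d n δ := by
    unfold oppExcess irreducibleOpp
    positivity
  refine le_add_of_le_of_nonneg (le_ciInf fun h => ?_) hexcess
  rw [hsub hmem h.2]

variable [IsFiniteMeasure P]

theorem GoodGroup.abs_empTruePosRate_sub_le {a : Bool} (hz : GoodGroup P H α (n * R) z a)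
    (hz' : IsCorruption z z') (hn : 0 < n) (hR : 0 ≤ R) (hα' : α < 1 / 2) (hp : 0 < p)
    (hpa : p ≤ posRate P a) (hh : h ∈ H) :
    |empTruePosRate (fun i => (z' i).1) h a - truePosRate P h a| ≤
      hitCount (posGroup X a ×ˢ {true}) z' /
        (hitCount (posGroup X a ×ˢ {false}) z + hitCount (posGroup X a ×ˢ {true}) z') +
        80 * √(R / p) := by
  have hn' : (0 : ℝ) < n := Nat.cast_pos.2 hn
  have hα1 : 0 < 1 - α := by linarith
  have hmass : p / 2 ≤ (1 - α) * posRate P a := by nlinarith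
  have hnmass : 0 < n * ((1 - α) * posRate P a) := mul_pos hn' (by linarith)
  have hdev : |hitCount (truePositives h a ×ˢ {false}) z / hitCount (posGroup X a ×ˢ {false}) z -
      truePosRate P h a| ≤ 80 * √(R / p) := by
    rw [truePosRate_eq_div, ← mul_div_mul_left (P.real _) (posRate P a) hα1.ne']
    exact (abs_div_sub_div_le hnmass (mul_nonneg hα1.le measureReal_nonneg)
      (mul_le_mul_of_nonneg_left (measureReal_mono (truePositives_subset h a)) hα1.le)
      (hz.positive h hh) hz.group hz.large).trans (four_mul_deviationRadius_div_le hn' hp hmass hR)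
  exact (abs_sub_le _ _ _).trans (add_le_add
    (hz'.abs_empTruePosRate_sub_le h ((half_pos hnmass).trans_le hz.large)) hdev)

theorem GoodSample.abs_empOppDeviation_sub_le (hz : GoodSample P H α (n * R) z)
    (hz' : IsCorruption z z') (hn : 0 < n) (hR : 0 ≤ R) (hα' : α < 1 / 2) (hp : 0 < p)
    (hpa : ∀ a, p ≤ posRate P a) (hh : h ∈ H) :
    |empOppDeviation (fun i => (z' i).1) h - oppDeviation P h| ≤
      irreducibleOpp α p + 160 * √(R / p) := by
  have hn' : (0 : ℝ) < n := Nat.cast_pos.2 hn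
  have hα1 : 0 ≤ 1 - α := by linarith
  have hlarge (a : Bool) : n * ((1 - α) * p) / 2 ≤ hitCount (posGroup X a ×ˢ {false}) z := by
    refine le_trans ?_ (hz.groups a).large
    gcongr
    exact hpa a
  have hrate (a : Bool) :=
    (hz.groups a).abs_empTruePosRate_sub_le hz' hn hR hα' hp (hpa a) hh
  have hmarked : hitCount (posGroup X false ×ˢ {true}) z' +
      hitCount (posGroup X true ×ˢ {true}) z' ≤ 3 / 2 * (n * α) :=
    (hitCount_prod_true_add_le disjoint_posGroup z').trans (hz'.hitCount_marked.le.trans hz.marks)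
  have hshift := shift_le_irreducibleOpp hα' hp hn' (hlarge false) (hlarge true)
    (hitCount_nonneg _ z') (hitCount_nonneg _ z') hmarked
  rw [empOppDeviation, oppDeviation]
  refine (abs_abs_sub_abs_le _ _).trans ?_
  rw [sub_sub_sub_comm]
  refine (abs_sub _ _).trans ?_
  linarith [hrate false, hrate true]

theorem GoodSample.abs_empOppObjective_sub_le (hz : GoodSample P H α (n * R) z)
    (hz' : IsCorruption z z') (hlam : 0 ≤ lam) (hn : 0 < n) (hR : 0 ≤ R) (hα' : α < 1 / 2)
    (hp : 0 < p) (hpa : ∀ a, p ≤ posRate P a) (hh : h ∈ H) :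
    |empOppObjective lam (fun i => (z' i).1) h - oppObjective P lam h| ≤
      3 / 2 * α + 14 * √R + lam * (irreducibleOpp α p + 160 * √(R / p)) := by
  rw [empOppObjective, oppObjective, add_sub_add_comm, ← mul_sub]
  refine (abs_add_le _ _).trans (add_le_add (hz.abs_empRisk_sub_le hz' hn hR hh) ?_)
  rw [abs_mul, abs_of_nonneg hlam]
  exact mul_le_mul_of_nonneg_left (hz.abs_empOppDeviation_sub_le hz' hn hR hα' hp hpa hh) hlam

theorem GoodSample.oppObjective_le {d : ℕ} {δ : ℝ} {L : Learner X}
    (hz : GoodSample P H α (n * logRate d δ n) z) (hz' : IsCorruption z z')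
    (hL : IsOppMinimizer H lam L) (hlam : 0 ≤ lam) (hn : 0 < n) (hR : 0 ≤ logRate d δ n)
    (hα' : α < 1 / 2) (hp : 0 < p) (hpa : ∀ a, p ≤ posRate P a) :
    oppObjective P lam (L n fun i => (z' i).1) ≤
      (⨅ h : H, oppObjective P lam h) + oppExcess 320 α lam p d n δ := by
  obtain ⟨hmem, hmin⟩ := hL n hn fun i => (z' i).1
  have : Nonempty H := ⟨⟨_, hmem⟩⟩
  have hclose {h : Classifier X} (hh : h ∈ H) :=
    abs_le.1 (hz.abs_empOppObjective_sub_le hz' hlam hn hR hα' hp hpa hh)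
  rw [← sub_le_iff_le_add]
  refine le_ciInf fun h => ?_
  rw [oppExcess]
  linarith [(hclose hmem).1, (hclose h.2).2, hmin h h.2, Real.sqrt_nonneg (logRate d δ n)]

end Closeness

section LogRate

variable {d n : ℕ} {δ : ℝ}

theorem mul_exp_mul_logRate (hd : 0 < d) (hn : 0 < n) (hδ : 0 < δ) :
    δ * Real.exp (n * logRate d δ n) = (2 * Real.exp 1 * n / d) ^ d := by
  have hlog : n * logRate d δ n = d * Real.log (2 * Real.exp 1 * n / d) + Real.log (1 / δ) :=
    mul_div_cancel₀ _ (by positivity)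
  rw [hlog, Real.exp_add, Real.exp_log (by positivity), Real.exp_nat_mul,
    Real.exp_log (by positivity), mul_one_div, mul_div_cancel₀ _ hδ.ne']

theorem logRate_pos (hd : 0 < d) (hn : 0 < n) (hdn : d ≤ 2 * n) (hδ : 0 < δ)
    (hδ1 : δ ≤ 1) : 0 < logRate d δ n := by
  have hK : 1 ≤ n * logRate d δ n := one_le_of_exp_one_le_mul_exp hδ1
    ((exp_one_le_two_mul_div_pow hd hdn).trans (mul_exp_mul_logRate hd hn hδ).ge)
  exact pos_of_mul_pos_right (zero_lt_one.trans_le hK) n.cast_nonneg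

theorem sampleSize_pos {α p : ℝ} (hα' : α < 1 / 2) (hp : 0 < p) (hδ : 0 < δ) (hδ1 : δ < 1)
    (hn : 8 * Real.log (16 / δ) / ((1 - α) * p) ≤ n) : 0 < n := by
  have hlog : 0 < Real.log (16 / δ) := Real.log_pos (by rw [lt_div_iff₀ hδ]; linarith)
  have hmass : 0 < (1 - α) * p := mul_pos (by linarith) hp
  exact Nat.cast_pos.1 (hn.trans_lt' (by positivity))

end LogRate

section CorruptedData

variable {X : Type u} {n : ℕ}

theorem isCorruption_corrupted (𝒜 : MaliciousAdversary.{u, v} X n)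
    (ω : Dataset X n × (Fin n → Bool) × 𝒜.Seed) :
    IsCorruption (fun i => (ω.1 i, ω.2.1 i)) (fun i => (corrupted 𝒜 ω i, ω.2.1 i)) :=
  fun i => ⟨rfl, fun hi => Prod.ext (𝒜.corrupt_unmarked ω.1 ω.2.1 ω.2.2 i hi) rfl⟩

variable [MeasurableSpace X] {P : Measure (Example X)} [IsProbabilityMeasure P] {α : ℝ}

theorem measurePreserving_process (hα : 0 ≤ α) (hα1 : α ≤ 1) (𝒜 : MaliciousAdversary.{u, v} X n) :
    MeasurePreserving
      (fun (ω : Dataset X n × (Fin n → Bool) × 𝒜.Seed) (i : Fin n) => (ω.1 i, ω.2.1 i))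
      (processLaw P α 𝒜) (markedSampleLaw P α n) := by
  have := isProbabilityMeasure_markLaw hα hα1
  have hforget := (MeasurePreserving.id (Measure.pi fun _ : Fin n => P)).prod
    (measurePreserving_fst (μ := Measure.pi fun _ : Fin n => markLaw α) (ν := 𝒜.seedLaw))
  exact (measurePreserving_arrowProdEquivProdArrow (Example X) Bool (Fin n) (fun _ => P)
    fun _ => markLaw α).symm.comp hforget

theorem processLaw_le_markedSampleLaw (hα : 0 ≤ α) (hα1 : α ≤ 1)
    (𝒜 : MaliciousAdversary.{u, v} X n) (B : Set (Fin n → Example X × Bool)) :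
    processLaw P α 𝒜 {ω | (fun i => (ω.1 i, ω.2.1 i)) ∈ B} ≤ markedSampleLaw P α n B :=
  (measurePreserving_process hα hα1 𝒜).measure_preimage_le B

variable {H : Set (Classifier X)} {lam δ : ℝ} {d : ℕ} {L : Learner X}

theorem measure_excess_lt_of_pos (hd : vcDim H ≤ d) (hd0 : 0 < d) (hlam : 0 ≤ lam)
    (hL : IsOppMinimizer H lam L) (hH : MeasurableClass P H) {p : ℝ} (hp : 0 < p)
    (hpa : ∀ a, p ≤ posRate P a) (hα : 0 ≤ α) (hα' : α < 1 / 2) (hδ : 0 < δ) (hδ1 : δ < 1)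
    (hn : 0 < n) (hgroup : 8 * Real.log (16 / δ) / ((1 - α) * p) ≤ n)
    (hmarks : 12 * Real.log (12 / δ) / α ≤ n) (hdn : d ≤ 2 * n)
    (𝒜 : MaliciousAdversary.{u, v} X n) :
    processLaw P α 𝒜 {ω | ¬ oppObjective P lam (L n (corrupted 𝒜 ω)) ≤
        (⨅ h : H, oppObjective P lam h) + oppExcess 320 α lam p d n δ} < ENNReal.ofReal δ := by
  have hα1 : α ≤ 1 := by linarith
  have := isProbabilityMeasure_markLaw hα hα1
  have hgroups (a : Bool) : 8 * Real.log (16 / δ) ≤ n * ((1 - α) * posRate P a) := by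
    rw [div_le_iff₀ (mul_pos (by linarith) hp)] at hgroup
    refine hgroup.trans ?_
    have : 0 ≤ 1 - α := by linarith
    gcongr
    exact hpa a
  have hbad := measure_not_goodSample_lt P hd hd0 hdn hH hα hα1 hδ hδ1
    (mul_exp_mul_logRate hd0 hn hδ).ge hmarks hgroups
  rw [measureReal_def, ← ENNReal.lt_ofReal_iff_toReal_lt (measure_ne_top _ _)] at hbad
  refine ((measure_mono fun ω => ?_).trans (processLaw_le_markedSampleLaw hα hα1 𝒜 _)).trans_lt hbad
  exact mt fun hgood => GoodSample.oppObjective_le hgood (isCorruption_corrupted 𝒜 ω) hL hlam hn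
    (logRate_pos hd0 hn hdn hδ hδ1.le).le hα' hp hpa

end CorruptedData

end FairLearning

theorem theorem6 :
    ∃ C : ℝ, 0 < C ∧
      ∀ (X : Type u) [MeasurableSpace X]
        (H : Set (FairLearning.Classifier X)) (d : ℕ) (_ : FairLearning.vcDim H = (d : ℕ∞))
        (lam : ℝ) (_ : 0 ≤ lam)
        (L : FairLearning.Learner X) (_ : FairLearning.IsOppMinimizer H lam L)
        (P : Measure (FairLearning.Example X)) [IsProbabilityMeasure P]
        (_ : FairLearning.MeasurableClass P H)
        (_ : 0 < FairLearning.posRate P false)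
        (_ : FairLearning.posRate P false ≤ FairLearning.posRate P true)
        (α : ℝ) (_ : 0 ≤ α) (_ : α < 1 / 2)
        (δ : ℝ) (_ : 0 < δ) (_ : δ < 1)
        (n : ℕ)
        (_ : 8 * Real.log (16 / δ) / ((1 - α) * FairLearning.posRate P false) ≤ n)
        (_ : 12 * Real.log (12 / δ) / α ≤ n)
        (_ : (d : ℝ) / 2 ≤ n)
        (𝒜 : FairLearning.MaliciousAdversary.{u, v} X n),
        -- the failure event has (outer) probability less than `δ`
        FairLearning.processLaw P α 𝒜
            {ω | ¬ FairLearning.oppObjective P lam (L n (FairLearning.corrupted 𝒜 ω)) ≤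
                (⨅ h : H, FairLearning.oppObjective P lam h) +
                  FairLearning.oppExcess C α lam (FairLearning.posRate P false) d n δ} <
          ENNReal.ofReal δ := by
  refine ⟨320, by norm_num, ?_⟩
  intro X _ H d hd lam hlam L hL P _ hH hpos hle α hα hα' δ hδ hδ1 n hgroup hmarks hdn 𝒜
  have hn := FairLearning.sampleSize_pos hα' hpos hδ hδ1 hgroup
  rcases Nat.eq_zero_or_pos d with rfl | hd0
  · have hsub := FairLearning.subsingleton_of_vcDim_eq_zero hd
    have hbound ω := FairLearning.oppObjective_le_of_subsingleton (P := P) (d := 0) (δ := δ)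
      (C := 320) hsub hlam hL hpos.le hα (by norm_num) hn (FairLearning.corrupted 𝒜 ω)
    simpa only [hbound, not_true_eq_false, Set.ofPred_false, measure_empty, ENNReal.ofReal_pos]
  · exact FairLearning.measure_excess_lt_of_pos hd.le hd0 hlam hL hH hpos
      (Bool.forall_bool.2 ⟨le_rfl, hle⟩) hα hα' hδ hδ1 hn hgroup hmarks
      (by exact_mod_cast (div_le_iff₀' two_pos).1 hdn) 𝒜
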